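/- Let $G$ be a finite simple graph with vertex set $V$. Its minimum rank $\mathrm{mr}(G)$ is the least rank of a real symmetric matrix $A=(a_{uv})_{u,v\in V}$ such that, for all $u\ne v$, $a_{uv}\ne 0$ if and only if $uv$ is an edge of $G$ (the diagonal of $A$ is unrestricted). For a set $S\subseteq V$, colour the vertices of $S$ blue and the others white, and apply the following rule as often as possible: if a blue vertex has exactly one white neighbour, that neighbour becomes blue. The zero forcing number $Z(G)$ is the least size of a set $S$ for which all vertices become blue. Let $G_1,\dots,G_{1252}$ be the graphs of order at most $7$ in the *Atlas of Graphs* of Read and Wilson, in Atlas numbering. (They are sorted by order, then by size, i.e. number of edges, then lexicographically by increasing degree sequence, then by increasing number of automorphisms, with four exceptions at the numbers $1008$, $1009$, $1012$, $1013$; graphs that agree in all these data are numbered as in the explicit list of graphs in the formal statement. In particular, of the five graphs $G_{338},\dots,G_{342}$ with degree sequence $1122233$, the graph $G_{339}$ is the one that consists of a triangle $abc$, the edges $cd$, $de$, $df$ and the edge $fg$.) The numbers of graphs of order $n$ and size $0,1,\dots,\binom n2$ are - $n=1$: 1; $n=2$: 1, 1; $n=3$: 1, 1, 1, 1; $n=4$: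 1, 1, 2, 3, 2, 1, 1; $n=5$: 1, 1, 2, 4, 6, 6, 6, 4, 2, 1, 1; - $n=6$: 1, 1, 2, 5, 9, 15, 21, 24, 24, 21, 15, 9, 5, 2, 1, 1; - $n=7$: 1, 1, 2, 5, 10, 21, 41, 65, 97, 131, 148, 148, 131, 97, 65, 41, 21, 10, 5, 2, 1, 1; so that $G_1$ has order $1$, and the orders $2,3,4,5,6,7$ are those of $G_2$–$G_3$, $G_4$–$G_7$, $G_8$–$G_{18}$, $G_{19}$–$G_{52}$, $G_{53}$–$G_{208}$, $G_{209}$–$G_{1252}$. **Theorem (table of minimum ranks).** Every graph of order between $1$ and $7$ is isomorphic to $G_k$ for exactly one $k\in\{1,\dots,1252\}$. The order and the size of $G_k$ are as just listed, and $\mathrm{mr}(G_k)$ is the $k$-th digit of the following table: - $k=1,\dots,50$: $0010121012\,2123222101\,2212332223\,4223333313\,3232223222$ - $k=51,\dots,100$: $2101221233\,3222342344\,2333332344\,4353313323\,2344444443$ - $k=101,\dots,150$: $3444422232\,4443423434\,3444334433\,2233344343\,3333324433$ - $k=151,\dots,200$: $3433233333\,2334234333\,3333213333\,3333333322\,2332232322$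 - $k=201,\dots,250$: $2322222101\,2212333222\,3423444233\,3332344435\,3334455313$ - $k=251,\dots,300$: $3232344444\,4343444422\,3444454455\,4445364442\,2324443423$ - $k=301,\dots,350$: $4343444334\,3433445445\,5544435544\,5555355545\,5544443555$ - $k=351,\dots,400$: $5353223334\,4343333332\,4433334344\,5354543445\,5455443555$ - $k=401,\dots,450$: $5544444444\,4555443344\,5554445444\,4555545554\,4444554444$ - $k=451,\dots,500$: $3233333233\,4234333333\,3234444554\,4545444554\,4444435444$ - $k=501,\dots,550$: $3344443554\,4544555544\,4444355555\,4454444444\,4444444544$ - $k=551,\dots,600$: $3443443354\,5454454443\,4445544444\,4213333333\,3333322444$ - $k=601,\dots,650$: $4444444443\,3344344534\,4554444443\,4544444445\,4443454444$ - $k=651,\dots,700$: $4444444444\,4444443332\,4444444344\,3554433435\,4445444444$ - $k=701,\dots,750$: $4444444445\,4444444444\,3444334443\,2332232324\,4434244444$ - $k=751,\dots,800$: $4444444444\,4444444444\,4444444443\,3444433432\,3444434444$ - $k=801,\dots,850$: $3444444434\,4353344444\,5444444434\,3344444445\,4444434444$ - $k=851,\dots,900$: $3444434444\,4434344434\,4333434322\,3223344444\,4433334344$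 - $k=901,\dots,950$: $3344434434\,3334444344\,4443344444\,3344444444\,4443343334$ - $k=951,\dots,1000$: $4434433344\,4444444443\,4434343344\,4433443343\,3443334443$ - $k=1001,\dots,1050$: $3333342422\,2333443333\,4333444344\,4243333343\,4343344434$ - $k=1051,\dots,1100$: $4444433443\,4333433343\,4333333434\,3443333243\,4343334333$ - $k=1101,\dots,1150$: $4333332333\,3333334433\,4333334333\,3333333332\,4433433334$ - $k=1151,\dots,1200$: $3334333334\,3332333333\,2133333333\,3332334234\,3333333333$ - $k=1201,\dots,1250$: $3333323233\,2323323333\,3333323322\,3322332232\,3222232222$ - $k=1251,\dots,1252$: $21$ Moreover, whenever $G_k$ is connected, $\mathrm{mr}(G_k)=|G_k|-Z(G_k)$. -/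

import Mathlib

/-!
Simple graphs of order at most seven, numbered as in the *Atlas of Graphs* of Read and Wilson,
their minimum ranks, and the zero forcing number.
-/

namespace SimpleGraph

/-- `A` is a real symmetric matrix described by `G`: for `i ≠ j` the entry `A i j` is nonzero
exactly when `i` and `j` are adjacent. The diagonal of `A` is unrestricted. -/
def IsDescribedBy {V : Type*} (A : Matrix V V ℝ) (G : SimpleGraph V) : Prop :=
  A.IsSymm ∧ ∀ i j : V, i ≠ j → (A i j ≠ 0 ↔ G.Adj i j)

/-- The minimum rank `mr(G)`: the least rank of a real symmetric matrix described by `G`. -/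
noncomputable def minRank {V : Type*} [Fintype V] (G : SimpleGraph V) : ℕ :=
  sInf {r : ℕ | ∃ A : Matrix V V ℝ, IsDescribedBy A G ∧ A.rank = r}

/-- The minimum defining `minRank` is over a nonempty set, so it is attained. -/
theorem exists_rank_eq_minRank {V : Type*} [Fintype V] (G : SimpleGraph V) :
    ∃ A : Matrix V V ℝ, IsDescribedBy A G ∧ A.rank = G.minRank := by
  classical
  have hne : {r : ℕ | ∃ A : Matrix V V ℝ, IsDescribedBy A G ∧ A.rank = r}.Nonempty := by
    refine ⟨_, G.adjMatrix ℝ, ⟨G.isSymm_adjMatrix, fun i j _ => ?_⟩, rfl⟩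
    simp [SimpleGraph.adjMatrix_apply]
  exact Nat.sInf_mem hne

/-- `G.Forced S v`: the vertex `v` is eventually blue when exactly the vertices of `S` are blue
at the start and the color-change rule is applied as often as possible. The rule: if `w` is the
only neighbor of a blue vertex `u` that is not blue, then `w` becomes blue. -/
inductive Forced {V : Type*} (G : SimpleGraph V) (S : Set V) : V → Prop
  | start (v : V) (hv : v ∈ S) : Forced G S v
  | force (u w : V) (hu : Forced G S u) (huw : G.Adj u w)
      (hothers : ∀ x : V, G.Adj u x → x ≠ w → Forced G S x) : Forced G S w

/-- A zero forcing set: a set of vertices from which all of `G` is eventually blue. -/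
def IsZeroForcing {V : Type*} (G : SimpleGraph V) (S : Set V) : Prop :=
  ∀ v : V, G.Forced S v

/-- The zero forcing number `Z(G)`: the least size of a zero forcing set. -/
noncomputable def zeroForcingNumber {V : Type*} [Fintype V] (G : SimpleGraph V) : ℕ :=
  sInf {k : ℕ | ∃ S : Finset V, G.IsZeroForcing (S : Set V) ∧ S.card = k}

end SimpleGraph

/-- The graph on the vertices `0, …, n - 1` with code `c`: for `i < j`, the vertices `i` and `j`
are adjacent exactly when the binary digit of `c` of weight `2 ^ (j * (j - 1) / 2 + i)` is one. -/
def codedGraph (n c : ℕ) : SimpleGraph (Fin n) where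
  Adj i j := i ≠ j ∧
    c.testBit (max i.val j.val * (max i.val j.val - 1) / 2 + min i.val j.val) = true
  symm := ⟨fun i j h => ⟨h.1.symm, by simpa only [max_comm, min_comm] using h.2⟩⟩
  loopless := ⟨fun _ h => h.1 rfl⟩

/-- Pairs each code of a list with the order `n`. -/
def coded (n : ℕ) (codes : List ℕ) : List (ℕ × ℕ) :=
  codes.map fun c => (n, c)

/-- The catalogue of the *Atlas of Graphs*, as pairs (order, code), from graph 1 to graph 1252.
The graphs are listed by increasing order, then increasing size, then lexicographically by
increasing degree sequence (its terms sorted increasingly), then by increasing number of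
automorphisms, with the known exceptions of the *Atlas*: graph 1008 (degree sequence 3333345),
graph 1009 (two copies of the complete graph of order four sharing a vertex), and the interchanged
graphs 1012 (degree sequence 1244555) and 1013 (degree sequence 1244456). Graphs that agree in all
of these data are numbered as listed here. -/
def atlasCatalogue : List (ℕ × ℕ) :=
  -- graph 1: order 1, size 0
  coded 1 [0] ++
  -- graph 2: order 2, size 0
  coded 2 [0] ++
  -- graph 3: order 2, size 1
  coded 2 [1] ++
  -- graph 4: order 3, size 0
  coded 3 [0] ++
  -- graph 5: order 3, size 1
  coded 3 [4] ++
  -- graph 6: order 3, size 2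
  coded 3 [6] ++
  -- graph 7: order 3, size 3
  coded 3 [7] ++
  -- graph 8: order 4, size 0
  coded 4 [0] ++
  -- graph 9: order 4, size 1
  coded 4 [32] ++
  -- graphs 10 to 11: order 4, size 2
  coded 4 [48, 33] ++
  -- graphs 12 to 14: order 4, size 3
  coded 4 [52, 56, 50] ++
  -- graphs 15 to 16: order 4, size 4
  coded 4 [60, 51] ++
  -- graph 17: order 4, size 5
  coded 4 [62] ++
  -- graph 18: order 4, size 6
  coded 4 [63] ++
  -- graph 19: order 5, size 0
  coded 5 [0] ++
  -- graph 20: order 5, size 1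
  coded 5 [512] ++
  -- graphs 21 to 22: order 5, size 2
  coded 5 [768, 516] ++
  -- graphs 23 to 26: order 5, size 3
  coded 5 [800, 896, 784, 769] ++
  -- graphs 27 to 32: order 5, size 4
  coded 5 [928, 788, 960, 904, 786, 801] ++
  -- graphs 33 to 38: order 5, size 5
  coded 5 [944, 992, 936, 929, 852, 787] ++
  -- graphs 39 to 44: order 5, size 6
  coded 5 [948, 1008, 946, 993, 937, 504] ++
  -- graphs 45 to 48: order 5, size 7
  coded 5 [1012, 1016, 1010, 947] ++
  -- graphs 49 to 50: order 5, size 8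
  coded 5 [1020, 1011] ++
  -- graph 51: order 5, size 9
  coded 5 [1022] ++
  -- graph 52: order 5, size 10
  coded 5 [1023] ++
  -- graph 53: order 6, size 0
  coded 6 [0] ++
  -- graph 54: order 6, size 1
  coded 6 [16384] ++
  -- graphs 55 to 56: order 6, size 2
  coded 6 [24576, 16416] ++
  -- graphs 57 to 61: order 6, size 3
  coded 6 [25088, 28672, 24832, 24580, 16417] ++
  -- graphs 62 to 70: order 6, size 4
  coded 6 [29184, 24864, 30720, 28800, 24848, 25092, 28673, 24833, 12480] ++
  -- graphs 71 to 85: order 6, size 5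
  coded 6 [
    29440, 31232, 29312, 26912, 29188, 24852, 31744, 30784, 28864, 23048, 28808, 29185, 24850,
    25094, 24865] ++
  -- graphs 86 to 106: order 6, size 6
  coded 6 [
    29472, 31488, 29456, 31236, 29316, 15232, 32256, 31296, 29320, 31234, 27936, 29314, 26976,
    15168, 28896, 29441, 29189, 26913, 25876, 24851, 25095] ++
  -- graphs 107 to 130: order 6, size 7
  coded 6 [
    31520, 31616, 31504, 29460, 32512, 31552, 31496, 28448, 29458, 29473, 32260, 30340, 31300,
    31489, 16256, 29080, 29457, 29324, 15240, 31235, 29315, 26977, 15169, 28897] ++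
  -- graphs 131 to 154: order 6, size 8
  coded 6 [
    31648, 31508, 32544, 31584, 32640, 32528, 31568, 31624, 31506, 28452, 30484, 31521, 29461,
    32513, 31553, 16320, 31497, 31064, 24344, 28449, 29326, 27050, 29459, 15242] ++
  -- graphs 155 to 175: order 6, size 9
  coded 6 [
    31664, 32672, 31656, 32532, 31572, 31649, 32704, 32648, 31576, 32530, 32545, 31458, 31570,
    31626, 31585, 16352, 31507, 28453, 30485, 29327, 15243] ++
  -- graphs 176 to 190: order 6, size 10
  coded 6 [
    31668, 32688, 31666, 32736, 32680, 31658, 32596, 32673, 31580, 31657, 31224, 32531, 31571,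
    31627, 16353] ++
  -- graphs 191 to 199: order 6, size 11
  coded 6 [32692, 32752, 32690, 31667, 32737, 32681, 32248, 31582, 31659] ++
  -- graphs 200 to 204: order 6, size 12
  coded 6 [32756, 32760, 32754, 32691, 31583] ++
  -- graphs 205 to 206: order 6, size 13
  coded 6 [32764, 32755] ++
  -- graph 207: order 6, size 14
  coded 6 [32766] ++
  -- graph 208: order 6, size 15
  coded 6 [32767] ++
  -- graph 209: order 7, size 0
  coded 7 [0] ++
  -- graph 210: order 7, size 1
  coded 7 [1048576] ++
  -- graphs 211 to 212: order 7, size 2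
  coded 7 [1572864, 1049088] ++
  -- graphs 213 to 217: order 7, size 3
  coded 7 [1589248, 1835008, 1581056, 1572896, 1049092] ++
  -- graphs 218 to 227: order 7, size 4
  coded 7 [1851392, 1581568, 1966080, 1839104, 1581312, 1589280, 1835012, 1581060, 792576, 1572897] ++
  -- graphs 228 to 248: order 7, size 5
  coded 7 [1859584, 1982464, 1855488, 1712640, 1851424, 1581344, 2031616, 1968128, 1841152, 1458304,
    1839232, 1851396, 1581328, 1589296, 1581572, 1966081, 1839105, 920576, 1315008, 1581313,
    1589281] ++
  -- graphs 249 to 289: order 7, size 6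
  coded 7 [1860096, 1990656, 1859840, 1982496, 1855520, 946176, 2048000, 1984512, 1855616, 1982480,
    1778176, 1855504, 1714688, 1841664, 944128, 1859588, 1646880, 1712644, 1851428, 1581332,
    1589300, 2064384, 2032640, 1969152, 1968192, 1523776, 1982465, 1841216, 1855489, 936960,
    1712264, 1262088, 1720344, 1712641, 1851425, 1839240, 254464, 1581330, 1589298, 1581574,
    1581345] ++
  -- graphs 290 to 354: order 7, size 7
  coded 7 [1991168, 1994752, 1990912, 1859872, 2056192, 1992704, 1990784, 1794560, 1859856, 1860100,
    2048032, 1921056, 1984544, 1990660, 1011712, 1847680, 1855648, 1859844, 946304, 1982484,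
    1855508, 944132, 1714692, 1841668, 2080768, 2049024, 1985536, 1984576, 2048008, 1810944,
    1984520, 1794056, 1779200, 1990657, 1969664, 1008640, 1303040, 1714752, 1855624, 1847488,
    1859841, 1778178, 1916962, 1679648, 1982482, 1982497, 1714690, 1853474, 1855506, 1841666,
    1647904, 944130, 873504, 936992, 1838368, 1855521, 1859590, 946177, 1614100, 1646881,
    1839377, 1851429, 1622068, 1581331, 1581575] ++
  -- graphs 355 to 451: order 7, size 8
  coded 7 [1995264, 1990944, 2056704, 1993216, 2060288, 2056448, 1992960, 1994880, 1990928, 1794592,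
    1925408, 1991172, 1859876, 2056196, 1992708, 1013760, 1990788, 1976704, 1532288, 1794564,
    1855664, 1859860, 1716880, 946320, 2088960, 2057216, 2056256, 1827328, 1992768, 1986048,
    1990792, 1794568, 1991169, 2080800, 2049056, 1953824, 2056194, 1044480, 1922080, 1992706,
    1985568, 1012736, 1994753, 1913152, 1925378, 1990786, 1921120, 1532224, 1794562, 1976640,
    1011776, 1430272, 1990913, 1978560, 1984608, 1696032, 1684224, 1855656, 1859858, 1716872,
    1855768, 946312, 1859873, 1860102, 2015252, 2048033, 1888276, 1921057, 1990661, 1984545,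
    1983508, 1969668, 1874192, 976900, 1874436, 1008644, 1011713, 1847681, 1847492, 1714756,
    1859845, 1841732, 1452480, 1855572, 1855649, 932032, 944196, 1651457, 1982483, 1968266,
    1714691, 1855507, 1841667, 873505, 944131, 936993, 1859591] ++
  -- graphs 452 to 582: order 7, size 9
  coded 7 [1995520, 2060800, 1995392, 2056480, 1992992, 1995268, 2062336, 2060416, 1993088, 2056464,
    2056708, 1989136, 1992976, 1994896, 1993220, 1014272, 1794596, 1925412, 1990932, 1855668,
    946324, 2089472, 2057728, 1993280, 2093056, 2061312, 2089216, 2057472, 2060352, 1962240,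
    1993024, 1994944, 2056456, 1827360, 1958176, 2056706, 1992968, 1989128, 1922592, 1993218,
    1986080, 1926432, 1994888, 1013248, 1995265, 1990930, 1925410, 1794594, 1684256, 1991174,
    1990945, 2088964, 2025476, 2057220, 2060289, 1046528, 2023556, 2009472, 2044096, 2056260,
    2056449, 1565056, 1827332, 1992961, 1986052, 1991812, 1977728, 1980608, 1992772, 1795588,
    1012864, 1533312, 1994881, 1013824, 1990929, 1986712, 1794328, 1990796, 1749648, 1761456,
    1528456, 1976712, 1794593, 1761812, 1984680, 1925409, 1892628, 1303312, 1888432, 1782408,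
    1747616, 1532296, 1794572, 1991173, 1855666, 1859862, 1716882, 1859877, 946322, 2080801,
    2049057, 2056195, 1044481, 1922081, 1992707, 1985569, 1012737, 1990787, 1532225, 1913153,
    1430273, 1976641, 1516992, 1525505, 1984594, 1978561, 1794563, 1984609, 1684225, 520384,
    1855657, 1460568, 1716873, 1714520, 1855769, 1859859, 946313, 1716440, 1722488, 1841496,
    1860103] ++
  -- graphs 583 to 730: order 7, size 10
  coded 7 [1995552, 2061056, 1995536, 2062848, 2060928, 1995408, 2058528, 2060804, 1993120, 1995396,
    1981312, 2056468, 1992980, 1994900, 1014276, 2093568, 2061824, 2060864, 1962752, 1995400,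
    2089248, 2057504, 2060802, 1962272, 1993056, 1995394, 1981248, 1994976, 1995521, 2095104,
    2093184, 2061440, 2062400, 2060480, 2025856, 2089232, 2089476, 1831440, 2060424, 2053648,
    2025744, 2021904, 2060801, 2054664, 2057488, 2025988, 2027664, 2057732, 1047040, 1993040,
    1981120, 1989200, 1994960, 1995393, 1993284, 1993096, 1014336, 2056466, 1958180, 2023700,
    1827364, 2056710, 2056481, 1992978, 1986084, 1991956, 1923618, 1989138, 1922596, 1795620,
    1908512, 1992993, 1010976, 1926436, 1013252, 1993222, 1995269, 1927458, 1994898, 1014274,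
    1888436, 1925413, 1921329, 1990933, 1874352, 2093057, 2061313, 1047552, 2089217, 2076864,
    2057473, 2060353, 1962241, 2045120, 1568960, 1046592, 1993025, 1977792, 1994945, 2056457,
    2052184, 1827096, 1815176, 1827361, 1958177, 2049136, 2056707, 1992969, 1989129, 1988696,
    1922593, 1922328, 1791512, 1986081, 1973896, 1985816, 1783432, 1529480, 1007112, 1012872,
    1994889, 1784392, 1926433, 1993219, 1013249, 1013832, 1925390, 1921194, 1430290, 1921132,
    1913226, 1990931, 1990798, 1794574, 1794595, 1925411, 1696050, 1011850, 1696294, 1976714,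
    1684242, 1984682, 1684257, 1991175, 1855667, 1859863, 1716883, 946323] ++
  -- graphs 731 to 878: order 7, size 11
  coded 7 [2061088, 2063104, 2061072, 1995540, 2062852, 2060932, 2046848, 1993136, 1995412, 2093824,
    2062080, 2061064, 1962784, 1995538, 1995553, 2095616, 2093696, 2061952, 2062912, 2028176,
    2060936, 2091296, 2093572, 2059552, 2061828, 2062850, 1962400, 2058592, 2028164, 2060868,
    2060930, 1569664, 2060512, 2025888, 2046784, 1962756, 2014080, 2061057, 1993128, 1995160,
    1995404, 1981320, 1995410, 1995537, 2089236, 2025748, 2057492, 2060805, 2058529, 2027668,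
    1047044, 1981124, 1993044, 1993121, 1995397, 1994964, 1014340, 1981313, 1522624, 2096128,
    2095168, 2093248, 2061504, 2087432, 2093192, 2093569, 2061448, 2055688, 2061825, 2062408,
    1048064, 2060865, 2060488, 2025864, 1569472, 2057608, 2045632, 1831560, 1962753, 1993048,
    1995401, 1994968, 2089234, 2089478, 2089249, 1956386, 1829410, 2051618, 1962258, 2057490,
    2057484, 2058506, 1960226, 1047042, 2060803, 2057734, 2060426, 2057505, 1962273, 1043744,
    1941280, 1962502, 1914336, 1981122, 1992930, 1915714, 1923682, 1927522, 1989202, 1993042,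
    1993286, 1883010, 1993098, 1995395, 1993057, 1977824, 1521600, 1012960, 1994962, 1981249,
    1994977, 2023701, 1954097, 1958181, 2056467, 2056711, 1991957, 1922597, 1795621, 1986085,
    1989139, 978196, 1013253, 1889460, 1926437, 1992979, 1010977, 1908513, 1994899, 1875732,
    1993223, 1494804, 1014275, 980116, 1990799, 1984606, 1976715, 1984683] ++
  -- graphs 879 to 1009: order 7, size 12
  coded 7 [2063136, 2063232, 2063120, 2061076, 1993140, 2093856, 2062112, 2095872, 2063168, 2093840,
    2062096, 2060064, 2063112, 2061074, 2028308, 1962788, 2061089, 2095620, 2093700, 2079616,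
    2061956, 2063105, 2062916, 2047872, 2060696, 2060940, 2061073, 2028180, 1831600, 2025904,
    2046856, 1993138, 1995414, 1995541, 2096640, 2095680, 2062016, 2093704, 2061960, 2062920,
    2095618, 2092320, 2093698, 2091360, 2079552, 2093280, 2093825, 2061954, 2059616, 2060034,
    2047808, 2062914, 2061536, 1957664, 2062081, 1048320, 2060632, 2057640, 2060938, 1831592,
    2058600, 2028178, 1962408, 1962770, 2061065, 1831704, 1962785, 1993130, 1995406, 1981322,
    1995539, 2093573, 2090260, 2091297, 2061829, 2059553, 2026772, 2062851, 2028692, 1048068,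
    1962401, 1569476, 2013892, 2025812, 1962324, 2028165, 2060869, 2058593, 1962757, 2057556,
    1569665, 1047108, 2060931, 2025889, 2027732, 2045636, 2046785, 2060513, 2014081, 1555392,
    1989212, 1988856, 1993129, 1784664, 1993052, 1995405, 1981321, 1995161, 1792632, 1994972,
    1014104, 1014348, 1995411, 2089235, 2057491, 2060427, 1047043, 2057735, 1981123, 1977810,
    1993043, 1989203, 1994963, 1977825, 1521601, 1883011, 1993099, 1993287, 507840, 2057485,
    2089479] ++
  -- graphs 1010 to 1106: order 7, size 13
  coded 7 [2063264, 2063124, 2063200, 2095904, 2096000, 2095888, 2063184, 2063240, 2093844, 2060068,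
    2062100, 2063122, 2063137, 2061077, 2025908, 2096896, 2095936, 2095880, 2092832, 2062048,
    2063176, 2093842, 2093857, 2062098, 2060066, 2063114, 2062113, 1048352, 2096644, 2094724,
    2095684, 2095873, 2080640, 2062020, 2063169, 2047936, 2093464, 2093841, 2093708, 2079624,
    2062097, 2061720, 2023088, 2055960, 2061964, 2063113, 2027284, 2047880, 2060065, 1048336,
    2026928, 2062680, 2029204, 2062924, 2060942, 1831602, 1962774, 1962418, 2028182, 2025906,
    2061075, 2058666, 2046858, 2028309, 1962789, 1993139, 1995415, 2095619, 2093699, 2079553,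
    2091361, 2093281, 2061955, 2061522, 2047809, 2062915, 2061537, 1048321, 1556416, 1831593,
    2057641, 2060633, 1831160, 1817432, 2058601, 2053368, 2060939, 1962409, 2028179, 1831705,
    1993054, 1926574, 1927534, 1995407, 1993131, 1981323, 1994974] ++
  -- graphs 1107 to 1171: order 7, size 14
  coded 7 [2063280, 2096032, 2063272, 2095892, 2063188, 2063265, 2096928, 2095968, 2063208, 2097024,
    2096912, 2095952, 2096008, 2063192, 2095890, 2092836, 2094868, 2095905, 2062052, 2063074,
    2063186, 2047968, 2063201, 2062164, 2063242, 2093845, 2060069, 2062101, 2026932, 2063123,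
    1048340, 2096897, 2095937, 2080704, 2095881, 2095448, 2088728, 2092833, 2062049, 2061784,
    2063177, 2047944, 2093710, 2091434, 2093843, 2079626, 2060046, 2059690, 2059628, 2061966,
    1957682, 2060067, 2062099, 1048338, 2063115, 2062926, 1961766, 1048353, 2025907, 2028183,
    1831603, 2060943, 2046859, 1993055, 1994975] ++
  -- graphs 1172 to 1212: order 7, size 15
  coded 7 [2063284, 2096048, 2063282, 2097056, 2096040, 2063274, 2096916, 2095956, 2096033, 2063196,
    2063273, 2062840, 2097088, 2097032, 2095960, 2096914, 2096929, 2095842, 2095954, 2096010,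
    2095969, 2080736, 2063194, 2061816, 2063209, 2094869, 2092837, 2095891, 2062053, 2063187,
    2015188, 2062165, 2047969, 2026996, 2063243, 2093711, 2079627, 2061967, 2061534, 2062927,
    1048339] ++
  -- graphs 1213 to 1233: order 7, size 16
  coded 7 [2096052, 2097072, 2096050, 2063283, 2097120, 2097064, 2096042, 2096980, 2097057, 2095964,
    2096041, 2095608, 2063198, 2063275, 2096915, 2095955, 2096011, 2080737, 2061817, 2063195,
    1818616] ++
  -- graphs 1234 to 1243: order 7, size 17
  coded 7 [2097076, 2097136, 2097074, 2096051, 2097121, 2097065, 2096632, 2095966, 2096043, 2063199] ++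
  -- graphs 1244 to 1248: order 7, size 18
  coded 7 [2097140, 2097144, 2097138, 2097075, 2095967] ++
  -- graphs 1249 to 1250: order 7, size 19
  coded 7 [2097148, 2097139] ++
  -- graph 1251: order 7, size 20
  coded 7 [2097150] ++
  -- graph 1252: order 7, size 21
  coded 7 [2097151]

/-- The order of graph `k` of the *Atlas*, for `1 ≤ k ≤ 1252`. -/
def atlasOrder (k : ℕ) : ℕ :=
  (atlasCatalogue.getD (k - 1) (0, 0)).1

/-- Graph `k` of the *Atlas*, for `1 ≤ k ≤ 1252`. -/
def atlasGraph (k : ℕ) : SimpleGraph (Fin (atlasOrder k)) :=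
  codedGraph (atlasOrder k) (atlasCatalogue.getD (k - 1) (0, 0)).2

/-- A row of the table of minimum ranks. -/
structure TableRow where
  /-- The column `|G|`: the number of vertices. -/
  order : ℕ
  /-- The column `Size`: the number of edges. -/
  size : ℕ
  /-- The column `mr(G)`: the minimum rank. -/
  mr : ℕ

/-- The rows for consecutive graphs that share the order `n` and the size `m`. -/
def rows (n m : ℕ) (ranks : List ℕ) : List TableRow :=
  ranks.map fun r => ⟨n, m, r⟩

/-- The table of minimum ranks, from graph 1 to graph 1252. -/
def minRankTable : List TableRow :=
  -- graph 1
  rows 1 0 [0] ++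
  -- graph 2
  rows 2 0 [0] ++
  -- graph 3
  rows 2 1 [1] ++
  -- graph 4
  rows 3 0 [0] ++
  -- graph 5
  rows 3 1 [1] ++
  -- graph 6
  rows 3 2 [2] ++
  -- graph 7
  rows 3 3 [1] ++
  -- graph 8
  rows 4 0 [0] ++
  -- graph 9
  rows 4 1 [1] ++
  -- graphs 10 to 11
  rows 4 2 [2, 2] ++
  -- graphs 12 to 14
  rows 4 3 [1, 2, 3] ++
  -- graphs 15 to 16
  rows 4 4 [2, 2] ++
  -- graph 17
  rows 4 5 [2] ++
  -- graph 18
  rows 4 6 [1] ++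
  -- graph 19
  rows 5 0 [0] ++
  -- graph 20
  rows 5 1 [1] ++
  -- graphs 21 to 22
  rows 5 2 [2, 2] ++
  -- graphs 23 to 26
  rows 5 3 [1, 2, 3, 3] ++
  -- graphs 27 to 32
  rows 5 4 [2, 2, 2, 3, 4, 2] ++
  -- graphs 33 to 38
  rows 5 5 [2, 3, 3, 3, 3, 3] ++
  -- graphs 39 to 44
  rows 5 6 [1, 3, 3, 2, 3, 2] ++
  -- graphs 45 to 48
  rows 5 7 [2, 2, 3, 2] ++
  -- graphs 49 to 50
  rows 5 8 [2, 2] ++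
  -- graph 51
  rows 5 9 [2] ++
  -- graph 52
  rows 5 10 [1] ++
  -- graph 53
  rows 6 0 [0] ++
  -- graph 54
  rows 6 1 [1] ++
  -- graphs 55 to 56
  rows 6 2 [2, 2] ++
  -- graphs 57 to 61
  rows 6 3 [1, 2, 3, 3, 3] ++
  -- graphs 62 to 70
  rows 6 4 [2, 2, 2, 3, 4, 2, 3, 4, 4] ++
  -- graphs 71 to 85
  rows 6 5 [2, 3, 3, 3, 3, 3, 2, 3, 4, 4, 4, 3, 5, 3, 3] ++
  -- graphs 86 to 106
  rows 6 6 [1, 3, 3, 2, 3, 2, 3, 4, 4, 4, 4, 4, 4, 4, 3, 3, 4, 4, 4, 4, 2] ++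
  -- graphs 107 to 130
  rows 6 7 [2, 2, 3, 2, 4, 4, 4, 3, 4, 2, 3, 4, 3, 4, 3, 4, 4, 4, 3, 3, 4, 4, 3, 3] ++
  -- graphs 131 to 154
  rows 6 8 [2, 2, 3, 3, 3, 4, 4, 3, 4, 3, 3, 3, 3, 3, 3, 2, 4, 4, 3, 3, 3, 4, 3, 3] ++
  -- graphs 155 to 175
  rows 6 9 [2, 3, 3, 3, 3, 3, 2, 3, 3, 4, 2, 3, 4, 3, 3, 3, 3, 3, 3, 3, 2] ++
  -- graphs 176 to 190
  rows 6 10 [1, 3, 3, 3, 3, 3, 3, 3, 3, 3, 3, 3, 3, 2, 2] ++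
  -- graphs 191 to 199
  rows 6 11 [2, 3, 3, 2, 2, 3, 2, 3, 2] ++
  -- graphs 200 to 204
  rows 6 12 [2, 2, 3, 2, 2] ++
  -- graphs 205 to 206
  rows 6 13 [2, 2] ++
  -- graph 207
  rows 6 14 [2] ++
  -- graph 208
  rows 6 15 [1] ++
  -- graph 209
  rows 7 0 [0] ++
  -- graph 210
  rows 7 1 [1] ++
  -- graphs 211 to 212
  rows 7 2 [2, 2] ++
  -- graphs 213 to 217
  rows 7 3 [1, 2, 3, 3, 3] ++
  -- graphs 218 to 227
  rows 7 4 [2, 2, 2, 3, 4, 2, 3, 4, 4, 4] ++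
  -- graphs 228 to 248
  rows 7 5 [2, 3, 3, 3, 3, 3, 2, 3, 4, 4, 4, 3, 5, 3, 3, 3, 4, 4, 5, 5, 3] ++
  -- graphs 249 to 289
  rows 7 6 [
    1, 3, 3, 2, 3, 2, 3, 4, 4, 4, 4, 4, 4, 3, 4, 3, 4, 4, 4, 4, 2, 2, 3, 4, 4, 4, 4, 5, 4, 4,
    5, 5, 4, 4, 4, 5, 3, 6, 4, 4, 4] ++
  -- graphs 290 to 354
  rows 7 7 [
    2, 2, 3, 2, 4, 4, 4, 3, 4, 2, 3, 4, 3, 4, 3, 4, 4, 4, 3, 3, 4, 3, 4, 3, 3, 4, 4, 5, 4, 4,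
    5, 5, 5, 4, 4, 4, 3, 5, 5, 4, 4, 5, 5, 5, 5, 3, 5, 5, 5, 4, 5, 5, 5, 4, 4, 4, 4, 3, 5, 5,
    5, 5, 3, 5, 3] ++
  -- graphs 355 to 451
  rows 7 8 [
    2, 2, 3, 3, 3, 4, 4, 3, 4, 3, 3, 3, 3, 3, 3, 2, 4, 4, 3, 3, 3, 3, 4, 3, 4, 4, 5, 3, 5, 4,
    5, 4, 3, 4, 4, 5, 5, 4, 5, 5, 4, 4, 3, 5, 5, 5, 5, 5, 4, 4, 4, 4, 4, 4, 4, 4, 4, 5, 5, 5,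
    4, 4, 3, 3, 4, 4, 5, 5, 5, 4, 4, 4, 5, 4, 4, 4, 4, 5, 5, 5, 5, 4, 5, 5, 5, 4, 4, 4, 4, 4,
    5, 5, 4, 4, 4, 4, 3] ++
  -- graphs 452 to 582
  rows 7 9 [
    2, 3, 3, 3, 3, 3, 2, 3, 3, 4, 2, 3, 4, 3, 3, 3, 3, 3, 3, 3, 2, 3, 4, 4, 4, 4, 5, 5, 4, 4,
    5, 4, 5, 4, 4, 4, 5, 5, 4, 4, 4, 4, 4, 4, 3, 5, 4, 4, 4, 3, 3, 4, 4, 4, 4, 3, 5, 5, 4, 4,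
    5, 4, 4, 5, 5, 5, 5, 4, 4, 4, 4, 4, 4, 3, 5, 5, 5, 5, 5, 4, 4, 5, 4, 4, 4, 4, 4, 4, 4, 4,
    4, 4, 4, 4, 4, 4, 5, 4, 4, 3, 4, 4, 3, 4, 4, 3, 3, 5, 4, 5, 4, 5, 4, 4, 5, 4, 4, 4, 3, 4,
    4, 4, 5, 5, 4, 4, 4, 4, 4, 4, 2] ++
  -- graphs 583 to 730
  rows 7 10 [
    1, 3, 3, 3, 3, 3, 3, 3, 3, 3, 3, 3, 3, 2, 2, 4, 4, 4, 4, 4, 4, 4, 4, 4, 4, 4, 4, 3, 3, 3,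
    4, 4, 3, 4, 4, 5, 3, 4, 4, 5, 5, 4, 4, 4, 4, 4, 4, 3, 4, 5, 4, 4, 4, 4, 4, 4, 4, 5, 4, 4,
    4, 3, 4, 5, 4, 4, 4, 4, 4, 4, 4, 4, 4, 4, 4, 4, 4, 4, 4, 4, 4, 4, 4, 4, 3, 3, 3, 2, 4, 4,
    4, 4, 4, 4, 4, 3, 4, 4, 3, 5, 5, 4, 4, 3, 3, 4, 3, 5, 4, 4, 4, 5, 4, 4, 4, 4, 4, 4, 4, 4,
    4, 4, 4, 4, 4, 4, 4, 5, 4, 4, 4, 4, 4, 4, 4, 4, 4, 4, 3, 4, 4, 4, 3, 3, 4, 4, 4, 3] ++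
  -- graphs 731 to 878
  rows 7 11 [
    2, 3, 3, 2, 2, 3, 2, 3, 2, 4, 4, 4, 3, 4, 2, 4, 4, 4, 4, 4, 4, 4, 4, 4, 4, 4, 4, 4, 4, 4,
    4, 4, 4, 4, 4, 4, 4, 4, 4, 4, 4, 4, 4, 4, 4, 4, 4, 4, 4, 3, 3, 4, 4, 4, 4, 3, 3, 4, 3, 2,
    3, 4, 4, 4, 4, 3, 4, 4, 4, 4, 3, 4, 4, 4, 4, 4, 4, 4, 3, 4, 4, 3, 5, 3, 3, 4, 4, 4, 4, 4,
    5, 4, 4, 4, 4, 4, 4, 4, 3, 4, 3, 3, 4, 4, 4, 4, 4, 4, 4, 5, 4, 4, 4, 4, 4, 3, 4, 4, 4, 4,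
    3, 4, 4, 4, 4, 3, 4, 4, 4, 4, 4, 4, 3, 4, 3, 4, 4, 4, 3, 4, 4, 3, 3, 3, 4, 3, 4, 3] ++
  -- graphs 879 to 1009
  rows 7 12 [
    2, 2, 3, 2, 2, 3, 3, 4, 4, 4, 4, 4, 4, 4, 3, 3, 3, 3, 4, 3, 4, 4, 3, 3, 4, 4, 4, 3, 4, 4,
    3, 4, 3, 3, 3, 4, 4, 4, 4, 3, 4, 4, 4, 4, 4, 3, 3, 4, 4, 4, 4, 4, 3, 3, 4, 4, 4, 4, 4, 4,
    4, 4, 4, 4, 4, 3, 3, 4, 3, 3, 3, 4, 4, 4, 3, 4, 4, 3, 3, 3, 4, 4, 4, 4, 4, 4, 4, 4, 4, 4,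
    4, 3, 4, 4, 3, 4, 3, 4, 3, 3, 4, 4, 4, 4, 3, 3, 4, 4, 3, 3, 4, 3, 3, 4, 4, 3, 3, 3, 4, 4,
    4, 3, 3, 3, 3, 3, 3, 4, 2, 4, 2] ++
  -- graphs 1010 to 1106
  rows 7 13 [
    2, 2, 3, 3, 3, 4, 4, 3, 3, 3, 3, 4, 3, 3, 3, 4, 4, 4, 3, 4, 4, 4, 2, 4, 3, 3, 3, 3, 3, 4,
    3, 4, 3, 4, 3, 3, 4, 4, 4, 3, 4, 4, 4, 4, 4, 4, 3, 3, 4, 4, 3, 4, 3, 3, 3, 4, 3, 3, 3, 4,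
    3, 4, 3, 3, 3, 3, 3, 3, 4, 3, 4, 3, 4, 4, 3, 3, 3, 3, 2, 4, 3, 4, 3, 4, 3, 3, 3, 4, 3, 3,
    3, 4, 3, 3, 3, 3, 3] ++
  -- graphs 1107 to 1171
  rows 7 14 [
    2, 3, 3, 3, 3, 3, 3, 3, 3, 3, 4, 4, 3, 3, 4, 3, 3, 3, 3, 3, 4, 3, 3, 3, 3, 3, 3, 3, 3, 3,
    3, 3, 3, 2, 4, 4, 3, 3, 4, 3, 3, 3, 3, 4, 3, 3, 3, 4, 3, 3, 3, 3, 3, 4, 3, 3, 3, 2, 3, 3,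
    3, 3, 3, 3, 2] ++
  -- graphs 1172 to 1212
  rows 7 15 [
    1, 3, 3, 3, 3, 3, 3, 3, 3, 3, 3, 3, 2, 3, 3, 4, 2, 3, 4, 3, 3, 3, 3, 3, 3, 3, 3, 3, 3, 3,
    3, 3, 3, 3, 2, 3, 2, 3, 3, 2, 3] ++
  -- graphs 1213 to 1233
  rows 7 16 [2, 3, 3, 2, 3, 3, 3, 3, 3, 3, 3, 3, 3, 2, 3, 3, 2, 2, 3, 3, 2] ++
  -- graphs 1234 to 1243
  rows 7 17 [2, 3, 3, 2, 2, 3, 2, 3, 2, 2] ++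
  -- graphs 1244 to 1248
  rows 7 18 [2, 2, 3, 2, 2] ++
  -- graphs 1249 to 1250
  rows 7 19 [2, 2] ++
  -- graph 1251
  rows 7 20 [2] ++
  -- graph 1252
  rows 7 21 [1]

/-- The row of graph `k` of the *Atlas*, for `1 ≤ k ≤ 1252`. -/
def tableRow (k : ℕ) : TableRow :=
  minRankTable.getD (k - 1) ⟨0, 0, 0⟩

namespace SimpleGraph

/-! ### Zero forcing and rank -/

section ZeroForcing

variable {V : Type*} {G : SimpleGraph V}

theorem Forced.eq_zero [Fintype V] {A : Matrix V V ℝ} (hA : IsDescribedBy A G) {S : Set V} {v : V}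
    (hv : G.Forced S v) {x : V → ℝ} (hx : A.mulVec x = 0) (hS : ∀ s ∈ S, x s = 0) : x v = 0 := by
  classical
  induction hv with
  | start v hv => exact hS v hv
  | force u w hu huw hothers ihu ih =>
    have h0 : ∑ y, A u y * x y = 0 := congrFun hx u
    rw [Finset.sum_eq_single w ?_ (by simp)] at h0
    · exact (mul_eq_zero.1 h0).resolve_left ((hA.2 u w huw.ne).2 huw)
    · intro y _ hyw
      by_cases huy : u = y
      · rw [← huy, ihu, mul_zero]
      by_cases hadj : G.Adj u y
      · rw [ih y hadj hyw, mul_zero]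
      · rw [not_not.1 (mt (hA.2 u y huy).1 hadj), zero_mul]

/-- The nullity of a matrix described by `G` is at most the size of any zero forcing set. -/
theorem IsZeroForcing.card_le_rank_add_card [Fintype V] {A : Matrix V V ℝ}
    (hA : IsDescribedBy A G) {S : Finset V} (hS : G.IsZeroForcing S) :
    Fintype.card V ≤ A.rank + S.card := by
  classical
  let K := LinearMap.ker A.mulVecLin
  let ρ : K →ₗ[ℝ] (S → ℝ) := (LinearMap.funLeft ℝ ℝ (Subtype.val : S → V)).comp K.subtype
  have hρ : Function.Injective ρ := by
    rw [← LinearMap.ker_eq_bot, LinearMap.ker_eq_bot']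
    rintro ⟨x, hx⟩ h
    refine Subtype.ext (funext fun v => (hS v).eq_zero hA (by simpa [K] using hx) fun s hs => ?_)
    exact congrFun h ⟨s, hs⟩
  have h1 : Module.finrank ℝ K ≤ S.card := by
    simpa using LinearMap.finrank_le_finrank_of_injective hρ
  have h2 := LinearMap.finrank_range_add_finrank_ker A.mulVecLin
  rw [Module.finrank_fintype_fun_eq_card] at h2
  have h3 : A.rank = Module.finrank ℝ (LinearMap.range A.mulVecLin) := rfl
  have h4 : Module.finrank ℝ (LinearMap.ker A.mulVecLin) ≤ S.card := h1
  omega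

theorem exists_card_eq_zeroForcingNumber [Fintype V] (G : SimpleGraph V) :
    ∃ S : Finset V, G.IsZeroForcing (S : Set V) ∧ S.card = G.zeroForcingNumber :=
  Nat.sInf_mem (s := {k : ℕ | ∃ S : Finset V, G.IsZeroForcing (S : Set V) ∧ S.card = k})
    ⟨_, Finset.univ, fun v => .start v (by simp), rfl⟩

/-- The minimum rank is at least the number of vertices minus the zero forcing number. -/
theorem card_le_minRank_add_zeroForcingNumber [Fintype V] (G : SimpleGraph V) :
    Fintype.card V ≤ G.minRank + G.zeroForcingNumber := by
  obtain ⟨A, hA, hr⟩ := G.exists_rank_eq_minRank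
  obtain ⟨S, hS, hc⟩ := G.exists_card_eq_zeroForcingNumber
  rw [← hr, ← hc]
  exact hS.card_le_rank_add_card hA

theorem minRank_le_rank [Fintype V] {A : Matrix V V ℝ} (hA : IsDescribedBy A G) :
    G.minRank ≤ A.rank :=
  Nat.sInf_le ⟨A, hA, rfl⟩

/-- Adjacency as orthogonality with respect to a diagonal form bounds the minimum rank. -/
theorem minRank_le_of_vectors [Fintype V] {r : ℕ} (s : Fin r → ℝ) (x : Fin r → V → ℝ)
    (h : ∀ i j, i ≠ j → (∑ k, s k * (x k i * x k j) ≠ 0 ↔ G.Adj i j)) : G.minRank ≤ r := by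
  let X : Matrix (Fin r) V ℝ := Matrix.of x
  let Y : Matrix V (Fin r) ℝ := Matrix.of fun i k => s k * x k i
  have hXY : ∀ i j, (Y * X) i j = ∑ k, s k * (x k i * x k j) := fun i j => by
    simp [X, Y, Matrix.mul_apply, mul_assoc]
  have hA : IsDescribedBy (Y * X) G := by
    refine ⟨Matrix.IsSymm.ext fun i j => ?_, fun i j hij => by rw [hXY, h i j hij]⟩
    rw [hXY, hXY]
    exact Finset.sum_congr rfl fun k _ => by rw [mul_comm (x k j)]
  exact (minRank_le_rank hA).trans ((Matrix.rank_mul_le_right Y X).trans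
    (X.rank_le_card_height.trans_eq (Fintype.card_fin r)))

/-- A chronological list of forces `u t → w t` bounds the zero forcing number. -/
theorem zeroForcingNumber_add_le_of_forces [Fintype V] {r : ℕ} (u w : Fin r → V)
    (hadj : ∀ t, G.Adj (u t) (w t)) (hne : ∀ t s, t < s → u t ≠ w s)
    (hnadj : ∀ t s, t < s → ¬ G.Adj (u t) (w s)) :
    G.zeroForcingNumber + r ≤ Fintype.card V := by
  classical
  have hw : Function.Injective w := by
    intro t s hts
    by_contra hne'
    rcases lt_or_gt_of_ne hne' with h | h
    · exact hnadj t s h (hts ▸ hadj t)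
    · exact hnadj s t h (hts ▸ hadj s)
  let S : Finset V := (Finset.univ.image w)ᶜ
  have hforced : ∀ t, G.Forced S (w t) := by
    intro t
    induction t using WellFoundedLT.induction with
    | ind t ih =>
      have key : ∀ v, (∀ s, t ≤ s → v ≠ w s) → G.Forced S v := fun v hv => by
        by_cases h : ∃ s, w s = v
        · obtain ⟨s, rfl⟩ := h
          exact ih s (not_le.1 fun hts => hv s hts rfl)
        · exact .start v (by simpa [S] using h)
      refine .force (u t) (w t) (key _ fun s hts => ?_) (hadj t) fun v hv hvw => key _ fun s hts => ?_
      · rcases hts.eq_or_lt with rfl | hts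
        · exact (hadj t).ne
        · exact hne t s hts
      · rcases hts.eq_or_lt with rfl | hts
        · exact hvw
        · rintro rfl
          exact hnadj t s hts hv
  have hS : G.IsZeroForcing (S : Set V) := fun v => by
    by_cases h : ∃ s, w s = v
    · obtain ⟨s, rfl⟩ := h
      exact hforced s
    · exact .start v (by simpa [S] using h)
  have hle : G.zeroForcingNumber ≤ S.card := Nat.sInf_le ⟨S, hS, rfl⟩
  have hcard : S.card + r = Fintype.card V := by
    rw [← Finset.card_compl_add_card (Finset.univ.image w), Finset.card_image_of_injective _ hw,
      Finset.card_univ, Fintype.card_fin]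
  omega

end ZeroForcing

/-! ### An isomorphism invariant -/

section Invariant

variable {V W : Type*} [Fintype V] [Fintype W]

open Classical in
/-- The sum of `f` over the closed neighborhood of `v`. -/
noncomputable def closedSum (G : SimpleGraph V) (f : V → ℕ) (v : V) : ℕ :=
  ∑ w, if v = w ∨ G.Adj v w then f w else 0

/-- The sum of the sizes of the intersections of the closed neighborhood of `v` with those of the
vertices in it. -/
noncomputable def closedCodegree (G : SimpleGraph V) (v : V) : ℕ :=
  open Classical in
  G.closedSum (fun u => G.closedSum (fun w => if u = w ∨ G.Adj u w then 1 else 0) v) v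

/-- A sum over the vertices that separates the small graphs up to isomorphism. -/
noncomputable def closedInvariant (G : SimpleGraph V) : ℕ :=
  ∑ v, G.closedSum (fun w => G.closedSum G.closedCodegree w ^ 2) v ^ 2

theorem Iso.closedSum_eq {G : SimpleGraph V} {H : SimpleGraph W} (φ : G ≃g H) {f : V → ℕ}
    {g : W → ℕ} (h : ∀ v, g (φ v) = f v) (v : V) : H.closedSum g (φ v) = G.closedSum f v := by
  classical
  refine (Fintype.sum_equiv φ.toEquiv _ _ fun w => ?_).symm
  change _ = if φ v = φ w ∨ H.Adj (φ v) (φ w) then g (φ w) else 0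
  simp only [φ.injective.eq_iff, φ.map_adj_iff, h]

theorem Iso.closedCodegree_eq {G : SimpleGraph V} {H : SimpleGraph W} (φ : G ≃g H) (v : V) :
    H.closedCodegree (φ v) = G.closedCodegree v := by
  classical
  refine φ.closedSum_eq (fun u => φ.closedSum_eq (fun w => ?_) v) v
  exact if_congr (or_congr φ.injective.eq_iff φ.map_adj_iff) rfl rfl

theorem Iso.closedInvariant_eq {G : SimpleGraph V} {H : SimpleGraph W} (φ : G ≃g H) :
    H.closedInvariant = G.closedInvariant := by
  refine (Fintype.sum_equiv φ.toEquiv _ _ fun v => ?_).symm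
  exact congrArg (· ^ 2) (φ.closedSum_eq (fun w => congrArg (· ^ 2)
    (φ.closedSum_eq φ.closedCodegree_eq w)) v).symm

end Invariant

theorem Iso.ncard_edgeSet_eq {V W : Type*} {G : SimpleGraph V} {H : SimpleGraph W} (φ : G ≃g H) :
    G.edgeSet.ncard = H.edgeSet.ncard :=
  Nat.card_congr φ.mapEdgeSet

end SimpleGraph

/-! ### Bounded loops -/

/-- `p k` holds for all `k < n`, as a loop that the kernel evaluates quickly. -/
noncomputable def allBelow (n : ℕ) (p : ℕ → Bool) : Bool :=
  Nat.rec true (fun k ih => cond (p k) ih false) n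

/-- The sum of `f k` over `k < n`, as a loop that the kernel evaluates quickly. -/
noncomputable def sumBelow (n : ℕ) (f : ℕ → ℕ) : ℕ :=
  Nat.rec 0 (fun k ih => Nat.add (f k) ih) n

theorem allBelow_eq_true {n : ℕ} {p : ℕ → Bool} :
    allBelow n p = true ↔ ∀ k < n, p k = true := by
  induction n with
  | zero => simp [allBelow]
  | succ n ih =>
    have h : allBelow (n + 1) p = cond (p n) (allBelow n p) false := rfl
    rw [h, Bool.cond_false_right, Bool.and_eq_true, ih, Nat.forall_lt_succ_right, and_comm]

theorem sumBelow_eq_sum (n : ℕ) (f : ℕ → ℕ) : sumBelow n f = ∑ i : Fin n, f i := by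
  induction n with
  | zero => rfl
  | succ n ih =>
    have h : sumBelow (n + 1) f = f n + sumBelow n f := rfl
    rw [h, ih, Fin.sum_univ_castSucc, add_comm]
    rfl

/-! ### Adjacency in coded graphs -/

/-- The binary digit of `c` that decides the adjacency of `i` and `j`, for `i < j`. -/
def pairBit (c i j : ℕ) : Bool :=
  Nat.beq (Nat.land (Nat.shiftRight c (Nat.add (Nat.div (Nat.mul j (Nat.sub j 1)) 2) i)) 1) 1

/-- Adjacency of `i` and `j` in the graph with code `c`. -/
def codeAdj (c i j : ℕ) : Bool :=
  cond (Nat.ble j i) (cond (Nat.ble i j) false (pairBit c j i)) (pairBit c i j)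

theorem land_one_beq_one (x a : ℕ) :
    Nat.beq (Nat.land (Nat.shiftRight x a) 1) 1 = x.testBit a := by
  rw [Bool.eq_iff_iff, Nat.testBit_eq_decide_div_mod_eq, decide_eq_true_iff, Nat.beq_eq]
  change (x >>> a) &&& 1 = 1 ↔ _
  rw [Nat.and_one_is_mod, Nat.shiftRight_eq_div_pow]

theorem pairBit_eq_testBit (c i j : ℕ) : pairBit c i j = c.testBit (j * (j - 1) / 2 + i) :=
  land_one_beq_one c _

theorem codeAdj_of_lt {i j : ℕ} (c : ℕ) (h : i < j) :
    codeAdj c i j = c.testBit (j * (j - 1) / 2 + i) := by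
  have h1 : Nat.ble j i = false := by
    rw [← Bool.not_eq_true, Nat.ble_eq]; omega
  simp [codeAdj, h1, pairBit_eq_testBit]

theorem codeAdj_of_gt {i j : ℕ} (c : ℕ) (h : j < i) :
    codeAdj c i j = c.testBit (i * (i - 1) / 2 + j) := by
  have h1 : Nat.ble j i = true := by rw [Nat.ble_eq]; omega
  have h2 : Nat.ble i j = false := by
    rw [← Bool.not_eq_true, Nat.ble_eq]; omega
  simp [codeAdj, h1, h2, pairBit_eq_testBit]

theorem codeAdj_self (c i : ℕ) : codeAdj c i i = false := by
  simp [codeAdj]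

theorem codeAdj_comm (c i j : ℕ) : codeAdj c i j = codeAdj c j i := by
  rcases lt_trichotomy i j with h | rfl | h
  · rw [codeAdj_of_lt c h, codeAdj_of_gt c h]
  · rfl
  · rw [codeAdj_of_lt c h, codeAdj_of_gt c h]

theorem codedGraph_adj {n c : ℕ} {i j : Fin n} :
    (codedGraph n c).Adj i j ↔ codeAdj c i j = true := by
  change (i ≠ j ∧ _) ↔ _
  rcases lt_trichotomy i j with h | rfl | h
  · rw [codeAdj_of_lt c h, max_eq_right (Fin.lt_def.1 h).le, min_eq_left (Fin.lt_def.1 h).le]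
    exact and_iff_right h.ne
  · simp [codeAdj_self]
  · rw [codeAdj_of_gt c h, max_eq_left (Fin.lt_def.1 h).le, min_eq_right (Fin.lt_def.1 h).le]
    exact and_iff_right h.ne'

/-- The degree of `v` in the graph on `n` vertices with code `c`. -/
noncomputable def codeDegree (n c v : ℕ) : ℕ :=
  sumBelow n fun w => cond (codeAdj c v w) 1 0

/-! ### An isomorphism invariant, computed from the code -/

/-- The sum of `f` over the closed neighborhood of `v`. -/
noncomputable def codeClosedSum (n c : ℕ) (f : ℕ → ℕ) (v : ℕ) : ℕ :=
  sumBelow n fun w => cond (Nat.beq v w) (f w) (cond (codeAdj c v w) (f w) 0)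

/-- The value of `SimpleGraph.closedInvariant` for a coded graph. -/
noncomputable def codeInvariant (n c : ℕ) : ℕ :=
  sumBelow n fun v => Nat.pow (codeClosedSum n c (fun v => Nat.pow (codeClosedSum n c
    (fun v => codeClosedSum n c (fun u => codeClosedSum n c
      (fun w => cond (Nat.beq u w) 1 (cond (codeAdj c u w) 1 0)) v) v) v) 2) v) 2

/-- The numbers of the list are distinct and none of them is the place of a one in `mask`. -/
noncomputable def distinctFrom (l : List ℕ) : ℕ → Bool :=
  List.rec (fun _ => true) (fun a _ ih mask =>
    cond (Nat.beq (Nat.land (Nat.shiftRight mask a) 1) 1) false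
      (ih (Nat.lor mask (Nat.shiftLeft 1 a)))) l

/-! ### Checking isomorphisms -/

/-- The digit of `s` to base eight at place `i`. -/
def octalDigit (s i : ℕ) : ℕ :=
  Nat.land (Nat.shiftRight s (Nat.mul 3 i)) 7

/-- The octal digits of `s` are an isomorphism from the graph with code `d` to the graph with
code `c`, both of order `n`. -/
noncomputable def isoCheck (n c d s : ℕ) : Bool :=
  allBelow n fun j => cond (Nat.ble n (octalDigit s j)) false <| allBelow j fun i =>
    cond (Nat.beq (octalDigit s i) (octalDigit s j)) false <|
      cond (codeAdj d i j) (codeAdj c (octalDigit s i) (octalDigit s j))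
        (cond (codeAdj c (octalDigit s i) (octalDigit s j)) false true)

/-- The last vertex of the graph of order `n + 1` with code `c` has maximum degree. -/
noncomputable def lastIsMax (n c : ℕ) : Bool :=
  allBelow n fun v => Nat.ble (codeDegree (n + 1) c v) (codeDegree (n + 1) c n)

/-- The code of the graph that arises from the graph of order `n` with code `c` by a new last
vertex, with neighbors given by the binary digits of `m`. -/
def extensionCode (n c m : ℕ) : ℕ :=
  Nat.add (Nat.mul (Nat.pow 2 (Nat.div (Nat.mul n (Nat.sub n 1)) 2)) m) c

/-- The catalogue, packed into one number. -/
def atlasNumber : ℕ :=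
  atlasCatalogue.foldr (fun p x => Nat.add (Nat.mul 16777216 x) (Nat.add (Nat.mul 8 p.2) p.1)) 0

/-- The member of the catalogue at place `j`, as it is packed into `atlasNumber`. -/
def atlasDigit (j : ℕ) : ℕ :=
  Nat.mod (Nat.shiftRight atlasNumber (Nat.mul 24 j)) 16777216

/-- The entry `e` consists of the place of a graph in the catalogue, modulo 2048, and of an
isomorphism from this graph to the graph of order `n` with code `c`. -/
noncomputable def entryCheck (n c e : ℕ) : Bool :=
  cond (Nat.ble 1252 (Nat.mod e 2048)) false <|
    cond (Nat.beq (Nat.mod (atlasDigit (Nat.mod e 2048)) 8) n)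
      (isoCheck n c (Nat.div (atlasDigit (Nat.mod e 2048)) 8) (Nat.div e 2048)) false

/-- The entries of the list treat, in this order, the extensions of the graph of order `n` with
code `c` by a last vertex of maximum degree, the numbers of their neighborhoods decreasing
from `m - 1` to `0`. -/
noncomputable def extensionCheck (n c m : ℕ) : List ℕ → Bool :=
  Nat.rec (fun _ => true) (fun k ih l => cond (lastIsMax n (extensionCode n c k))
    (List.rec false (fun e l _ => cond (entryCheck (n + 1) (extensionCode n c k) e) (ih l) false) l)
    (ih l)) m

/-- The members of the first list are related by `f` to the members of the second list at the same
places. -/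
def pairwiseAll {α β : Type*} (f : α → β → Bool) : List α → List β → Bool
  | [], _ => true
  | _ :: _, [] => false
  | a :: l, b :: l' => cond (f a b) (pairwiseAll f l l') false

/-! ### Checking minimum ranks and zero forcing -/

/-- The sign of coordinate `k` in the diagonal form that is part of the certificate `d`. -/
def signBit (d k : ℕ) : Bool := Nat.beq (Nat.land (Nat.shiftRight d k) 1) 1

/-- Coordinate `k` of the vector at vertex `i` in the certificate `d`, increased by one. -/
def vectorDigit (n d k i : ℕ) : ℕ :=
  Nat.land (Nat.shiftRight d (Nat.add (Nat.mul 2 (Nat.add (Nat.mul k n) i)) 6)) 3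

/-- The product of the vectors at `i` and `j` is `positivePart n r d i j - negativePart n r d i j`. -/
noncomputable def positivePart (n r d i j : ℕ) : ℕ :=
  sumBelow r fun k => cond (signBit d k)
    (Nat.add (Nat.mul (vectorDigit n d k i) (vectorDigit n d k j)) 1)
    (Nat.add (vectorDigit n d k i) (vectorDigit n d k j))

/-- See `positivePart`. -/
noncomputable def negativePart (n r d i j : ℕ) : ℕ :=
  sumBelow r fun k => cond (signBit d k)
    (Nat.add (vectorDigit n d k i) (vectorDigit n d k j))
    (Nat.add (Nat.mul (vectorDigit n d k i) (vectorDigit n d k j)) 1)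

/-- In the certificate `d`, the vectors at two vertices are orthogonal exactly when the vertices are
not adjacent in the graph of order `n` with code `c`. -/
noncomputable def matrixCheck (n c r d : ℕ) : Bool :=
  allBelow n fun j => allBelow j fun i =>
    cond (Nat.beq (positivePart n r d i j) (negativePart n r d i j))
      (cond (codeAdj c i j) false true) (codeAdj c i j)

/-- The octal digits of `f` list `r` forces in chronological order, each by the forcing vertex and the
forced vertex. -/
noncomputable def forcingCheck (n c r f : ℕ) : Bool :=
  allBelow r fun s => cond (Nat.ble n (octalDigit f (2 * s))) false <|
    cond (Nat.ble n (octalDigit f (2 * s + 1))) false <|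
    cond (codeAdj c (octalDigit f (2 * s)) (octalDigit f (2 * s + 1)))
      (allBelow s fun t => cond (Nat.beq (octalDigit f (2 * t)) (octalDigit f (2 * s + 1))) false <|
        cond (codeAdj c (octalDigit f (2 * t)) (octalDigit f (2 * s + 1))) false true) false

/-- The certificate `d` proves the row `p.2` of the table for the graph `p.1`. -/
noncomputable def rowCheck (p : (ℕ × ℕ) × TableRow) (d : ℕ × ℕ) : Bool :=
  cond (Nat.beq p.2.order p.1.1)
    (cond (Nat.beq (sumBelow p.1.1 (codeDegree p.1.1 p.1.2)) (Nat.mul 2 p.2.size))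
      (cond (matrixCheck p.1.1 p.1.2 p.2.mr d.1)
        (forcingCheck p.1.1 p.1.2 p.2.mr d.2) false) false) false

theorem ble_eq_false_iff {a b : ℕ} : Nat.ble a b = false ↔ b < a := by
  rw [← Bool.not_eq_true, Nat.ble_eq, not_le]

/-! ### Degrees and the invariant of coded graphs -/

theorem cond_eq_one_or_zero (b : Bool) : cond b 1 0 = if b = true then 1 else 0 := by
  cases b <;> rfl

theorem codeDegree_eq_degree {n c : ℕ} [DecidableRel (codedGraph n c).Adj] (v : Fin n) :
    codeDegree n c v = (codedGraph n c).degree v := by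
  rw [codeDegree, sumBelow_eq_sum, ← SimpleGraph.card_neighborFinset_eq_degree,
    SimpleGraph.neighborFinset_eq_filter, Finset.card_filter]
  refine Finset.sum_congr rfl fun w _ => ?_
  rw [cond_eq_one_or_zero]
  exact if_congr codedGraph_adj.symm rfl rfl

theorem sumBelow_codeDegree (n c : ℕ) :
    sumBelow n (codeDegree n c) = 2 * (codedGraph n c).edgeSet.ncard := by
  classical
  rw [sumBelow_eq_sum, ← SimpleGraph.coe_edgeFinset, Set.ncard_coe_finset,
    ← SimpleGraph.sum_degrees_eq_twice_card_edges]
  exact Finset.sum_congr rfl fun v _ => codeDegree_eq_degree v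

theorem closed_cond_eq {n c : ℕ} (v w : Fin n) (a : ℕ)
    {_ : Decidable (v = w ∨ (codedGraph n c).Adj v w)} :
    cond (Nat.beq v w) a (cond (codeAdj c v w) a 0) =
      if v = w ∨ (codedGraph n c).Adj v w then a else 0 := by
  by_cases hvw : v = w
  · subst hvw
    simp
  · have h1 : Nat.beq v w = false := by
      rw [← Bool.not_eq_true, Nat.beq_eq]
      exact fun h => hvw (Fin.ext h)
    simp only [h1, hvw, false_or, cond_false, codedGraph_adj]
    cases codeAdj c v w <;> rfl

theorem codeClosedSum_eq_closedSum {n c : ℕ} {f : ℕ → ℕ} {g : Fin n → ℕ}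
    (h : ∀ v : Fin n, f v = g v) (v : Fin n) :
    codeClosedSum n c f v = (codedGraph n c).closedSum g v := by
  rw [codeClosedSum, sumBelow_eq_sum]
  exact Finset.sum_congr rfl fun w _ => (closed_cond_eq v w _).trans (by rw [h])

theorem codeInvariant_eq_closedInvariant (n c : ℕ) :
    codeInvariant n c = (codedGraph n c).closedInvariant := by
  rw [codeInvariant, sumBelow_eq_sum]
  refine Finset.sum_congr rfl fun v _ => ?_
  refine congrArg (· ^ 2) (codeClosedSum_eq_closedSum (fun w => ?_) v)
  refine congrArg (· ^ 2) (codeClosedSum_eq_closedSum (fun w => ?_) w)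
  refine codeClosedSum_eq_closedSum (fun u => ?_) w
  exact codeClosedSum_eq_closedSum (fun x => closed_cond_eq u x 1) w

theorem nodup_of_distinctFrom {l : List ℕ} {mask : ℕ} (h : distinctFrom l mask = true) :
    l.Nodup ∧ ∀ a ∈ l, mask.testBit a = false := by
  induction l generalizing mask with
  | nil => simp
  | cons a l ih =>
    have h' : cond (Nat.beq (Nat.land (Nat.shiftRight mask a) 1) 1) false
      (distinctFrom l (mask ||| 1 <<< a)) = true := h
    rw [land_one_beq_one] at h'
    cases ha : mask.testBit a
    · rw [ha, cond_false] at h'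
      obtain ⟨h1, h2⟩ := ih h'
      simp only [Nat.testBit_or, Bool.or_eq_false_iff, Nat.one_shiftLeft,
        Nat.testBit_two_pow, decide_eq_false_iff_not] at h2
      refine ⟨List.nodup_cons.2 ⟨fun hal => (h2 a hal).2 rfl, h1⟩, ?_⟩
      simpa [ha] using fun b hb => (h2 b hb).1
    · simp [ha] at h'

/-! ### Soundness of the isomorphism checks -/

theorem nonempty_iso_of_isoCheck {n c d s : ℕ} (h : isoCheck n c d s = true) :
    Nonempty (codedGraph n d ≃g codedGraph n c) := by
  simp only [isoCheck, allBelow_eq_true] at h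
  have hlt : ∀ j < n, octalDigit s j < n := fun j hj => by
    have := h j hj
    cases hb : Nat.ble n (octalDigit s j)
    · exact ble_eq_false_iff.1 hb
    · simp [hb] at this
  have hpair : ∀ j < n, ∀ i < j, octalDigit s i ≠ octalDigit s j ∧
      codeAdj d i j = codeAdj c (octalDigit s i) (octalDigit s j) := fun j hj i hi => by
    have h1 := h j hj
    rw [ble_eq_false_iff.2 (hlt j hj), cond_false, allBelow_eq_true] at h1
    have h2 := h1 i hi
    cases hs : Nat.beq (octalDigit s i) (octalDigit s j)
    · refine ⟨fun h' => by simp [h'] at hs, ?_⟩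
      rw [hs, cond_false] at h2
      revert h2
      cases codeAdj d i j <;> cases codeAdj c (octalDigit s i) (octalDigit s j) <;> simp
    · simp [hs] at h2
  let f : Fin n → Fin n := fun i => ⟨octalDigit s i, hlt i i.2⟩
  have hf : Function.Injective f := fun i j hij => by
    by_contra hne
    have hij' : octalDigit s i = octalDigit s j := congrArg Fin.val hij
    rcases lt_or_gt_of_ne hne with hlt' | hlt'
    · exact (hpair j j.2 i hlt').1 hij'
    · exact (hpair i i.2 j hlt').1 hij'.symm
  refine ⟨⟨Equiv.ofBijective f (Finite.injective_iff_bijective.1 hf), fun {i j} => ?_⟩⟩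
  change (codedGraph n c).Adj (f i) (f j) ↔ _
  rw [codedGraph_adj, codedGraph_adj]
  change codeAdj c (octalDigit s i) (octalDigit s j) = true ↔ _
  rcases lt_trichotomy i j with hij | rfl | hij
  · rw [(hpair j j.2 i hij).2]
  · simp [codeAdj_self]
  · rw [codeAdj_comm c, codeAdj_comm d, (hpair i i.2 j hij).2]

theorem exists_eq_codedGraph_extensionCode {n c : ℕ} (hc : c < 2 ^ (n * (n - 1) / 2))
    {G : SimpleGraph (Fin (n + 1))} (h : G.comap Fin.castSucc = codedGraph n c) :
    ∃ m < 2 ^ n, G = codedGraph (n + 1) (extensionCode n c m) := by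
  classical
  refine ⟨Nat.ofBits fun i : Fin n => decide (G.Adj i.castSucc (Fin.last n)),
    Nat.ofBits_lt_two_pow _, ?_⟩
  set m := Nat.ofBits fun i : Fin n => decide (G.Adj i.castSucc (Fin.last n)) with hm
  have hcode : extensionCode n c m = 2 ^ (n * (n - 1) / 2) * m + c := rfl
  have key : ∀ i j : Fin (n + 1), i < j →
      (G.Adj i j ↔ codeAdj (extensionCode n c m) i j = true) := fun i j hij => by
    rw [codeAdj_of_lt _ hij, hcode, Nat.testBit_two_pow_mul_add _ hc]
    obtain ⟨i, rfl⟩ := Fin.exists_castSucc_eq.2 (Fin.ne_last_of_lt hij)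
    induction j using Fin.lastCases with
    | last =>
      have h1 : n * (n - 1) / 2 + i - n * (n - 1) / 2 = (i : ℕ) := by omega
      rw [Fin.val_last, Fin.val_castSucc, if_neg (by omega), h1, hm, Nat.testBit_ofBits_lt _ _ i.2]
      simp
    | cast j =>
      have hij' : i < j := by simpa using hij
      have h1 : (j : ℕ) * (j - 1) / 2 + i < n * (n - 1) / 2 := by
        have h2 : (j + 1 : ℕ) * (j + 1 - 1) / 2 ≤ n * (n - 1) / 2 :=
          Nat.div_le_div_right (Nat.mul_le_mul j.2 (Nat.sub_le_sub_right j.2 1))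
        have h3 : (j + 1 : ℕ) * (j + 1 - 1) = j * (j - 1) + 2 * j := by
          obtain ⟨k, hk⟩ : ∃ k, (j : ℕ) = k + 1 := ⟨j - 1, by have := Fin.lt_def.1 hij'; omega⟩
          rw [hk]
          simp only [Nat.add_sub_cancel]
          ring
        have := Fin.lt_def.1 hij'
        omega
      rw [Fin.val_castSucc, Fin.val_castSucc, if_pos h1, ← codeAdj_of_lt _ hij', ← codedGraph_adj,
        ← h]
      rfl
  ext i j
  rw [codedGraph_adj]
  rcases lt_trichotomy i j with hij | rfl | hij
  · exact key i j hij
  · simp [codeAdj_self]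
  · rw [G.adj_comm, codeAdj_comm]
    exact key j i hij

theorem shiftRight_foldr_mod_mem {l : List (ℕ × ℕ)} (hl : ∀ p ∈ l, p.1 < 8 ∧ p.2 < 2097152)
    {j : ℕ} (hj : j < l.length) :
    ∃ p ∈ l, Nat.mod (Nat.shiftRight (l.foldr (fun p x => Nat.add (Nat.mul 16777216 x)
      (Nat.add (Nat.mul 8 p.2) p.1)) 0) (Nat.mul 24 j)) 16777216 = 8 * p.2 + p.1 := by
  induction l generalizing j with
  | nil => simp at hj
  | cons p l ih =>
    have hp := hl p (by simp)
    change ∃ q ∈ p :: l, ((16777216 * (l.foldr (fun p x => Nat.add (Nat.mul 16777216 x)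
      (Nat.add (Nat.mul 8 p.2) p.1)) 0) + (8 * p.2 + p.1)) >>> (24 * j)) % 16777216 = _
    cases j with
    | zero => exact ⟨p, by simp, by rw [Nat.mul_zero, Nat.shiftRight_zero]; omega⟩
    | succ j =>
      obtain ⟨q, hq, h⟩ := ih (fun p hp => hl p (by simp [hp])) (j := j) (by simpa using hj)
      refine ⟨q, by simp [hq], Eq.trans ?_ h⟩
      rw [show 24 * (j + 1) = 24 + 24 * j by ring, Nat.shiftRight_add]
      refine congrArg (fun x => (x >>> (24 * j)) % 16777216) ?_
      rw [Nat.shiftRight_eq_div_pow]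
      omega

theorem exists_of_pairwiseAll {α β : Type*} {f : α → β → Bool} {l : List α} {l' : List β}
    (h : pairwiseAll f l l' = true) {a : α} (ha : a ∈ l) : ∃ b, f a b = true := by
  induction l generalizing l' with
  | nil => simp at ha
  | cons x l ih =>
    cases l' with
    | nil => simp [pairwiseAll] at h
    | cons y l' =>
      rw [pairwiseAll, Bool.cond_false_right, Bool.and_eq_true] at h
      rcases List.mem_cons.1 ha with rfl | ha
      · exact ⟨y, h.1⟩
      · exact ih h.2 ha

theorem exists_entryCheck_of_extensionCheck {n c m k : ℕ} {l : List ℕ}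
    (h : extensionCheck n c m l = true) (hk : k < m)
    (hmax : lastIsMax n (extensionCode n c k) = true) :
    ∃ e, entryCheck (n + 1) (extensionCode n c k) e = true := by
  induction m generalizing l with
  | zero => simp at hk
  | succ m ih =>
    have h' : cond (lastIsMax n (extensionCode n c m)) (List.rec false (fun e l _ =>
        cond (entryCheck (n + 1) (extensionCode n c m) e) (extensionCheck n c m l) false) l)
        (extensionCheck n c m l) = true := h
    rcases Nat.lt_succ_iff_lt_or_eq.1 hk with hk | rfl
    · cases hm : lastIsMax n (extensionCode n c m)
      · exact ih (by simpa [hm] using h') hk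
      · rw [hm, cond_true] at h'
        cases l with
        | nil => simp at h'
        | cons e l =>
          dsimp only at h'
          rw [Bool.cond_false_right, Bool.and_eq_true] at h'
          exact ih h'.2 hk
    · rw [hmax, cond_true] at h'
      cases l with
      | nil => simp at h'
      | cons e l =>
        dsimp only at h'
        rw [Bool.cond_false_right, Bool.and_eq_true] at h'
        exact ⟨e, h'.1⟩

/-- A graph one of whose vertex deletions is a coded graph, the deleted vertex being of maximum
degree, is an extension of this coded graph. -/
theorem exists_iso_extensionCode {n c : ℕ} (hc : c < 2 ^ (n * (n - 1) / 2))
    {G : SimpleGraph (Fin (n + 1))} [DecidableRel G.Adj]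
    (hG : ∀ v, G.degree v ≤ G.degree (Fin.last n))
    (φ : G.comap Fin.castSucc ≃g codedGraph n c) :
    ∃ m < 2 ^ n, lastIsMax n (extensionCode n c m) = true ∧
      Nonempty (G ≃g codedGraph (n + 1) (extensionCode n c m)) := by
  classical
  let e : Fin (n + 1) ≃ Fin (n + 1) :=
    (finSuccEquivLast.trans (Equiv.optionCongr φ.toEquiv.symm)).trans finSuccEquivLast.symm
  have he : ∀ i : Fin n, e i.castSucc = (φ.symm i).castSucc := fun i => by
    simp only [e, Equiv.trans_apply, finSuccEquivLast_castSucc, Equiv.optionCongr_apply,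
      Option.map_some, finSuccEquivLast_symm_some]
    rfl
  have hlast : e (Fin.last n) = Fin.last n := by
    simp only [e, Equiv.trans_apply, finSuccEquivLast_last, Equiv.optionCongr_apply,
      Option.map_none, finSuccEquivLast_symm_none]
  obtain ⟨m, hm, h⟩ := exists_eq_codedGraph_extensionCode hc (G := G.comap e) (by
    ext i j
    change G.Adj (e i.castSucc) (e j.castSucc) ↔ _
    rw [he, he]
    exact φ.symm.map_adj_iff)
  let ψ : codedGraph (n + 1) (extensionCode n c m) ≃g G := h ▸ SimpleGraph.Iso.comap e G
  have hψ : ψ (Fin.last n) = Fin.last n := by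
    have : ∀ H (hH : G.comap e = H), (hH ▸ SimpleGraph.Iso.comap e G : H ≃g G) (Fin.last n) =
        Fin.last n := by
      rintro H rfl
      exact hlast
    exact this _ h
  refine ⟨m, hm, allBelow_eq_true.2 fun v hv => ?_, ⟨ψ.symm⟩⟩
  have h1 := codeDegree_eq_degree (n := n + 1) (c := extensionCode n c m) ⟨v, by omega⟩
  have h2 := codeDegree_eq_degree (n := n + 1) (c := extensionCode n c m) (Fin.last n)
  rw [Fin.val_last] at h2
  rw [Nat.ble_eq, h1, h2, ← ψ.degree_eq, ← ψ.degree_eq, hψ]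
  exact hG _

/-! ### Soundness of the certificates -/

theorem positivePart_sub_negativePart (n r d i j : ℕ) :
    ∑ k : Fin r, (if signBit d k = true then (1 : ℝ) else -1) *
      (((vectorDigit n d k i : ℝ) - 1) * ((vectorDigit n d k j : ℝ) - 1)) =
      positivePart n r d i j - negativePart n r d i j := by
  rw [positivePart, negativePart, sumBelow_eq_sum, sumBelow_eq_sum, Nat.cast_sum, Nat.cast_sum,
    ← Finset.sum_sub_distrib]
  refine Finset.sum_congr rfl fun k _ => ?_
  cases signBit d k
  · simp only [cond_false, Bool.false_eq_true, if_false, Nat.add_eq, Nat.mul_eq]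
    push_cast
    ring
  · simp only [cond_true, if_true, Nat.add_eq, Nat.mul_eq]
    push_cast
    ring

theorem minRank_le_of_matrixCheck {V : Type*} [Fintype V] {G : SimpleGraph V} {n c r d : ℕ}
    (φ : G ≃g codedGraph n c) (h : matrixCheck n c r d = true) : G.minRank ≤ r := by
  refine SimpleGraph.minRank_le_of_vectors
    (fun k : Fin r => if signBit d k = true then (1 : ℝ) else -1)
    (fun k v => (vectorDigit n d k (φ v) : ℝ) - 1) fun v w hvw => ?_
  have key : ∀ i j : Fin n, i < j → ((∑ k : Fin r, (if signBit d k = true then (1 : ℝ) else -1) *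
      (((vectorDigit n d k i : ℝ) - 1) * ((vectorDigit n d k j : ℝ) - 1)) ≠ 0) ↔
      (codedGraph n c).Adj i j) := fun i j hij => by
    have h1 := allBelow_eq_true.1 (allBelow_eq_true.1 h j j.2) i hij
    rw [positivePart_sub_negativePart, codedGraph_adj, sub_ne_zero, Ne, Nat.cast_inj]
    cases hb : Nat.beq (positivePart n r d i j) (negativePart n r d i j)
    · rw [hb, cond_false] at h1
      exact iff_of_true (Nat.ne_of_beq_eq_false hb) h1
    · rw [hb, cond_true] at h1
      refine iff_of_false (not_not.2 (Nat.eq_of_beq_eq_true hb)) fun h2 => ?_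
      simp [h2] at h1
  rw [← φ.map_adj_iff]
  rcases lt_or_gt_of_ne (φ.injective.ne hvw) with hlt | hlt
  · exact key _ _ hlt
  · rw [SimpleGraph.adj_comm, ← key _ _ hlt]
    simp only [mul_comm ((vectorDigit n d _ (φ v) : ℝ) - 1)]

theorem zeroForcingNumber_add_le_of_forcingCheck {V : Type*} [Fintype V] {G : SimpleGraph V}
    {n c r f : ℕ} (φ : G ≃g codedGraph n c) (h : forcingCheck n c r f = true) :
    G.zeroForcingNumber + r ≤ Fintype.card V := by
  simp only [forcingCheck, allBelow_eq_true] at h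
  have hcond : ∀ {a b : Bool}, cond a false b = true ↔ a = false ∧ b = true := fun {a b} => by
    cases a <;> simp
  have h' : ∀ s < r, (octalDigit f (2 * s) < n ∧ octalDigit f (2 * s + 1) < n) ∧
      codeAdj c (octalDigit f (2 * s)) (octalDigit f (2 * s + 1)) = true ∧
      ∀ t < s, octalDigit f (2 * t) ≠ octalDigit f (2 * s + 1) ∧
        codeAdj c (octalDigit f (2 * t)) (octalDigit f (2 * s + 1)) = false := fun s hs => by
    have h1 := h s hs
    simp only [hcond, Bool.cond_false_right, Bool.and_eq_true, allBelow_eq_true, ble_eq_false_iff,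
      and_true] at h1
    obtain ⟨h2, h3, h4, h5⟩ := h1
    exact ⟨⟨h2, h3⟩, h4, fun t ht => ⟨fun h6 => by simpa [h6] using (h5 t ht).1, (h5 t ht).2⟩⟩
  refine SimpleGraph.zeroForcingNumber_add_le_of_forces
    (fun t : Fin r => φ.symm ⟨octalDigit f (2 * t), (h' t t.2).1.1⟩)
    (fun t : Fin r => φ.symm ⟨octalDigit f (2 * t + 1), (h' t t.2).1.2⟩)
    (fun t => ?_) (fun t s hts => ?_) (fun t s hts => ?_)
  · rw [φ.symm.map_adj_iff, codedGraph_adj]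
    exact (h' t t.2).2.1
  · rw [φ.symm.injective.ne_iff, Ne, Fin.mk.injEq]
    exact ((h' s s.2).2.2 t hts).1
  · rw [φ.symm.map_adj_iff, codedGraph_adj, Bool.not_eq_true]
    exact ((h' s s.2).2.2 t hts).2

/-! ### Data -/

set_option maxRecDepth 20000 in
/-- For each graph of order at most six in the catalogue, the entries of `extensionCheck`: the octal
digits of the quotient by 2048 are an isomorphism to the extension from the graph in the catalogue
whose place, counted from zero, is the remainder. -/
def extensionData : List (List ℕ) := [
  [16386, 16385],
  [278533, 278532, 264196, 278531],
  [278534],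
  [3424268, 3424265, 3409929, 3424264, 3280905, 3309576, 3180552, 3424263],
  [3424270, 3424267, 2506765, 1474573, 2277386],
  [3424272, 1474575],
  [3424273],
  [36978716, 36978711, 36964375, 36978708, 36835351, 36864020, 36734996, 36978707, 35788823,
    35831828, 35702804, 36061203, 34656276, 35029011, 33982483, 36978706],
  [36978721, 36978714, 36964378, 36978710, 36835357, 29638680, 29624344, 35788829, 21381144,
    21366808, 34656281, 27803669, 27789333],
  [36978727, 36978720, 29638690, 29524002, 35831844, 21381147, 20463646, 12091422],
  [36978729, 36978723, 36964387, 36978719, 34656291, 36864030, 36735006, 34641955, 35831838,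
    35702814, 34656287],
  [36978732, 36978726, 27803688, 26771496, 18399272],
  [36978733, 36978731],
  [36978734, 36978728, 36046888, 29524010, 21022762, 12091429],
  [36978736, 18399279],
  [36978737, 36978735, 36046895, 35000367, 33839151],
  [36978738],
  [36978739],
  [372523084, 372523071, 372508735, 372523065, 372379711, 372408377, 372279353, 372523062,
    371333183, 371376185, 371247161, 371605558, 370200633, 370573366, 369526838, 372523061,
    362946623, 363003961, 362874937, 363348022, 361828409, 362315830, 361269302, 365183029,
    353441849, 353943606, 352897078, 356925493, 344510518, 348553269, 340166709, 372523060],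
  [372523099, 372523079, 372508743, 372523069, 372379719, 372408381, 372279357, 372523064,
    371333197, 371376192, 371247168, 313802810, 370200640, 313688122, 313559098, 362946637,
    363003968, 362874944, 247742522, 361828416, 247627834, 247498810, 353441859, 353943611,
    352897083, 299122743, 344510523, 299008055, 298879031],
  [372523118, 372523094, 372508758, 372523078, 372379740, 313802824, 313788488, 371333212,
    312885320, 312870984, 313802830, 363348063, 363348041, 363333705, 247742526, 365039695,
    240402497, 240388161, 356653135, 173424705, 173410369, 313802821],
  [372523124, 372523096, 372508766, 372523082, 372379742, 372408394, 372279377, 372523074,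
    353900638, 353943626, 371247184, 371605569, 370200656, 370573377, 313559108, 353771614,
    353828938, 362874960, 363348033, 361828432, 362315841, 247498820, 353441873, 353943618,
    177281092, 111220804, 295911484],
  [372523140, 372523114, 372508778, 372523093, 372523121, 299122775, 299108439, 371605617,
    290865239, 290850903, 313802851, 363348081, 223887447, 223873111, 247742563, 180764771,
    296370259],
  [372523142, 372523115, 313802863, 313688175, 312655983, 372523128, 372523098, 313802850,
    313688162, 312655970],
  [372523143, 372523116, 372508784, 372523095, 365039728, 365068375, 299122781, 371376245,
    312885337, 312871008, 313688161, 362086517, 244875353, 247742561, 244846688, 353943655,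
    173424715, 289030226, 214597714],
  [372523151, 372523127, 372508791, 372523108, 372379766, 372408416, 372279392, 371333238,
    371376224, 371247200, 370200675, 344367229, 363348070, 363333734, 247742548, 344395877,
    247627858, 247498834, 344266853, 180535378, 180406354, 344510547],
  [372523163, 372523138, 313802885, 313688200, 312656008, 363348107, 223887469, 222969970,
    240402553, 173424761],
  [372523165, 372523139, 372523148, 372523117, 365068428, 365068397, 299122811, 356696204,
    356696173, 290865275, 282493052, 347406476, 347406445, 223887484, 215515259, 148422779],
  [372523168, 372523153],
  [372523169, 372523145, 372508808, 372379784, 312656016, 364939412, 372523132, 247498873,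
    247484537, 312656000],
  [372523171, 372523146, 371591306, 372523122, 365039762, 365068410, 313788539, 356538514,
    312885371, 356567162, 313688191, 362946707, 363004025, 355534969, 244846718, 176707710,
    214597736],
  [372523172, 372523149, 372508813, 372523123, 372523157, 299122810, 299108474, 371605653,
    290865274, 290850938, 313802881, 363348117, 223887482, 223873146, 247742593, 180764801,
    296370281],
  [372523184, 372523162, 299122844, 299008156, 312656030, 245563550, 295911566],
  [372523186, 372523177],
  [372523187, 372523164, 365168796, 299122850, 312885413, 245893285, 171589782],
  [372523190, 372523167, 313802920, 313688230, 312656038, 363348139, 223887502, 222970008,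
    240287895, 173195415],
  [372523189, 372523166, 372508839, 372379813, 371333285, 347406508, 347406478, 223887513,
    215515286, 148422806],
  [372523194, 372523178, 371591338, 372523160, 362287274, 365068440, 372279446, 352868522,
    371376278, 356567192, 344510614, 344367274, 362086550, 352782486, 347148440, 337844376],
  [372523198, 372523183, 296370353, 295338161, 286965937, 219873457],
  [372523199, 247742649],
  [372523200, 372523185, 299122868, 299008184, 290865335, 223887543],
  [372523202, 372523197],
  [372523203, 372523192, 365168824, 372379831, 312656059, 245434555, 171589805],
  [372523204, 372523193, 372508857, 372379833, 371333308, 362946748, 148422830],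
  [372523207, 219873473],
  [372523208],
  [372523209, 223887557],
  [372523210, 372523201, 299122886, 299008198, 312656069, 245563589],
  [372523212],
  [372523213, 223887563],
  [372523214],
  [372523215],
  [3593748749, 3593748713, 3593734377, 3593748699, 3593605353, 3593634011, 3593504987,
    3593748693, 3592558825, 3592601819, 3592472795, 3592831189, 3591426267, 3591798997,
    3590752469, 3593748690, 3584172265, 3584229595, 3584100571, 3584573653, 3583054043,
    3583541461, 3582494933, 3586408658, 3574667483, 3575169237, 3574122709, 3578151122,
    3565736149, 3569778898, 3561392338, 3593748689, 3517065449, 3517137115, 3517008091,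
    3517595861, 3515961563, 3516563669, 3515517141, 3520348370, 3507575003, 3508191445,
    3507144917, 3512090834, 3498758357, 3503718610, 3495332050, 3535028433, 3440468187,
    3441098965, 3440052437, 3445113042, 3431665877, 3436740818, 3428354258, 3468968145,
    3364559061, 3369648338, 3361261778, 3401990353, 3294154962, 3334897873, 3267791057, 3593748688],
  [3593748793, 3593748734, 3593734398, 3593748708, 3593605374, 3593634020, 3593504996,
    3593748697, 3592558846, 3592601828, 3592472804, 3592831193, 3591426276, 3591799001,
    3590752473, 3593748692, 3584172302, 3584229610, 3584100586, 3584573660, 3583054058,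
    3583541468, 3582494940, 3123986646, 3574667498, 3575169244, 3574122716, 3123069142,
    3565736156, 3122036950, 3120990422, 3517065486, 3517137130, 3517008106, 3517595868,
    3515961578, 3516563676, 3515517148, 2595504342, 3507575018, 3508191452, 3507144924,
    2594586838, 3498758364, 2593554646, 2592508118, 3440468210, 3441098975, 3440052447,
    3445113047, 3431665887, 3436740823, 3428354263, 3006546131, 3364559071, 3369648343,
    3361261783, 3005628627, 3294154967, 3004596435, 3003549907],
  [3593748858, 3593748773, 3593734437, 3593748729, 3593605413, 3593634041, 3593505017,
    3593748707, 3592558906, 3592601855, 3592472831, 3123986661, 3591426303, 3123871973,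
    3123742949, 3584172346, 3584229631, 3584100607, 3116646629, 3583054079, 3116531941,
    3116402917, 3574667535, 3123986667, 3123972331, 3123843307, 3520348478, 3520348418,
    3520334082, 3520348390, 3520205058, 3520233702, 3520104678, 2595504346, 3533838609,
    3533881580, 3533752556, 2536784093, 3532706028, 2536669405, 2536540381, 3466731793,
    3466789100, 3466660076, 2000961757, 3465613548, 2000847069, 2000718045, 3574667508,
    3123986657, 3123972321, 3123843297],
  [3593748867, 3593748779, 3593734443, 3593748731, 3593605437, 3593634049, 3593505025,
    3593748711, 3592558909, 3592601857, 3592472833, 3592831207, 3591426322, 3591799022,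
    3590752494, 3593748702, 3444711741, 3444769025, 3444640001, 3445113063, 3583054096,
    3583541485, 3582494957, 3586408669, 3574667536, 3575169261, 3574122733, 3578151133,
    3565736179, 3122036960, 3120990432, 3443665213, 3443736833, 3443607809, 3444195559,
    3515961616, 3516563693, 3515517165, 3520348381, 3507575056, 3508191469, 3507144941,
    3512090845, 3498758387, 2593554656, 2592508128, 3440468242, 3441098990, 3440052462,
    3445113054, 3431293171, 2031812832, 2030766304, 3364315379, 1503330528, 1502284000,
    3294154978, 2980856024, 2980841688],
  [3593748952, 3593748836, 3593734500, 3593748769, 3593605476, 3593634081, 3593505057,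
    3593748728, 3593748861, 3593748776, 3593734440, 3006546170, 3593605416, 3006431482,
    3006302458, 3586408829, 3586408744, 3586394408, 2940485882, 3586265384, 2940371194,
    2940242170, 3593748805, 3123986693, 3123972357, 3123843333, 3520348541, 3520348456,
    3520334120, 2404663546, 3520205096, 2404548858, 2404419834, 3535028549, 2595504389,
    2595490053, 2595361029, 3468968261, 2059682053, 2059667717, 2059538693, 3593748764,
    2984526064, 2984511728, 2984382704],
  [3593748955, 3593748838, 3593734502, 3593748770, 3593605499, 3123986726, 3123972390,
    3592558971, 3123069222, 3123054886, 3123986747, 3584172411, 3114811686, 3114797350,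
    3116646715, 3108389179, 3593748871, 3593748783, 3593734447, 3593748733, 3593605444,
    3123986694, 3123972358, 3592558916, 3123069190, 3123054854, 3123986709, 3584172356,
    3114811654, 3114797318, 3116646677, 3108389141],
  [3593748957, 3593748839, 3593734503, 3593748771, 3593605500, 3593634087, 3593505063,
    3593748730, 3533838716, 3533881639, 3533752615, 3534110970, 3591426364, 3006546176,
    3006531840, 3584573829, 3584573740, 3584559404, 3116646652, 3586265408, 3116531971,
    3116402947, 3577878849, 3123069188, 3123054852, 3123843347, 3510256005, 3510255916,
    3510241580, 2572566780, 3520205121, 2595504388, 2595490052, 3511818560, 2572337411,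
    2572208387, 2594314515, 3445113164, 3445113096, 3445098760, 2000961768, 3468824855,
    2925805807, 2925791471, 3394378007, 2330345711, 2330331375, 3006546165],
  [3593748982, 3593748847, 3593734534, 3593748782, 3593605510, 3593634094, 3593505090,
    3593748743, 3592558980, 3592601901, 3592472895, 3592831235, 3591426367, 3591799043,
    3123742996, 3584172420, 3584229677, 3584100671, 3584573699, 3583054143, 3583541507,
    3116402964, 3574667587, 3575169285, 3574122771, 3565736211, 3368501666, 3368501556,
    3520334154, 3520348425, 3520205130, 3520233737, 3520104729, 2595504369, 3368687947,
    3368730890, 3511703830, 2594586863, 3503331606, 2593554671, 2536540406, 3367641419,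
    3367698698, 3444597014, 2057847023, 3436224790, 2056814831, 2000718070, 3369146648,
    3369648368, 1519458549, 983636213],
  [3593749030, 3593748899, 3593734563, 3593748814, 3591426467, 3593634125, 3593505101,
    3593748762, 3591412131, 3592601933, 3592472909, 3592831258, 3591426382, 3591426330,
    3590508826, 3593748727, 3440468387, 3444769101, 3444640077, 3445113114, 3294040397,
    3583541531, 3582495003, 3586408694, 3293911373, 3575169307, 3574122779, 3578151158,
    3294155034, 3569406198, 3561148662, 3440454051, 3443736909, 3443607885, 3444195610,
    3293008205, 3516563739, 3515517211, 3520348406, 3292879181, 3508191515, 3507144987,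
    3512090870, 3293237530, 3503345910, 3495088374, 3440468302, 3440468250, 3439550746,
    3445113079, 3291832602, 3433128182, 3424870646, 3290915098, 3367067894, 3358810358, 3294154999],
  [3593749077, 3593748932, 3593734596, 3593748834, 3593605593, 3123986789, 3123972453,
    3592831456, 3123069288, 3123054952, 3123986815, 3584573920, 3114811752, 3114797416,
    3116646783, 3108389258, 3520348644, 3520348523, 3520334187, 2404663588, 3520205185,
    2397323561, 2397309225, 3534111125, 2536784176, 2536769840, 2536784200, 3467133333,
    2000961840, 2000947504, 2000961864, 3108389206],
  [3593749082, 3593748934, 3593734598, 3593748835, 3593748965, 3593748844, 3593734508,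
    3593748772, 3534111205, 3534111084, 3534096748, 3534111012, 3593748889, 3006546225,
    3006531889, 3467133413, 3467133292, 3467118956, 3467133220, 3586408857, 2940485937,
    2940471601, 3578151322, 2873508147, 2873493811, 3123986775, 3392815589, 3392815468,
    3392801132, 3392815396, 3520348570, 2404663603, 2404649267, 3512091033, 2337685809,
    2337671473, 2594586967, 3445113241, 1800945969, 1800931633, 2057847127, 1513767255, 2980856095],
  [3593749091, 3593748937, 3123986908, 3123872220, 3122840028, 3114467804, 3593748986,
    3593748849, 3123986827, 3123872139, 3122839947, 3114467723],
  [3593749092, 3593748938, 3593734623, 3593748841, 3593605598, 3593634152, 3123972478,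
    3592559070, 3592601960, 3123054974, 3591426431, 3584229879, 3114811760, 3114797449,
    3116532104, 3108159880, 3533079040, 3533078900, 3593734548, 3593748787, 3533050257,
    2593554736, 2536669510, 3532921233, 2593440048, 2535637318, 2593182024, 3584229803,
    3114811702, 3114797396, 3116532053, 3108159829],
  [3593749097, 3593748940, 3593734627, 3593748842, 3586265571, 3586294122, 3593505152,
    3593748777, 3533881851, 3533881714, 3534096782, 3534111026, 3591770512, 3123872049,
    3006531911, 3465871867, 3465871730, 3584559504, 3116646705, 3466072462, 3466101042,
    2940342599, 3575169450, 3123069239, 3123054927, 3113750863, 3517137404, 3517137267,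
    3517581709, 3517595952, 3457814925, 3457843504, 3520104774, 3508191652, 2572337461,
    2572552528, 2593554771, 3433759140, 2027225397, 2057847123, 2027426128, 3368501595,
    2330345739, 2503754013, 1959559453],
  [3593749098, 3593748941, 3593734630, 3593748845, 3593605606, 3593634157, 3593505154,
    3593748778, 3593748993, 3593748853, 3593734546, 3006546226, 3593605522, 3006431538,
    3006302537, 3586408961, 3586408821, 3586394514, 2940485938, 3586265490, 2940371250,
    2940242249, 3575169452, 3123986744, 3123972434, 3123843410, 3520348673, 3520348533,
    3520334226, 2404663602, 3520205202, 2404548914, 2404419913, 3508191660, 2595504440,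
    2595490130, 2595361106, 3441099180, 2059682104, 2059667794, 2059538770, 3369648479,
    2984526092, 2980856094, 2979823902],
  [3593749147, 3593748985, 3593734649, 3593748876, 3593605624, 3593634185, 3593505161,
    3592559096, 3592601993, 3592472969, 3591426442, 3584172536, 3584229769, 3584100745,
    3583054218, 3574667658, 3593749033, 3593748910, 3593734574, 3593748826, 3593605549,
    3593634132, 3593505108, 3592559021, 3592601940, 3592472916, 3591426390, 3584172461,
    3584229716, 3584100692, 3583054166, 3574667606],
  [3593749150, 3593748991, 3593734655, 3593748886, 3593605630, 3593634191, 3593505167,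
    3593748809, 3533838846, 3533881743, 3533752719, 3534111049, 3591426456, 3591799111,
    3590752583, 3583025703, 3584573861, 3584559525, 3116646744, 3583054247, 3116532049,
    3116403025, 3565492649, 3577921871, 3577792847, 3565736274, 3507546663, 3510256037,
    3510241701, 2572566872, 3498529193, 3520233807, 3520104783, 3507575207, 2572337489,
    2572208465, 3498744146, 3291832762, 3445113180, 3445098844, 2000961824, 3292205406,
    2000847133, 2000718109, 3291044190, 1397932317, 1397803293, 3294155038],
  [3593749151, 3593748989, 3593734653, 3593748887, 3532706301, 3593634195, 3593505171,
    3593748808, 3532691965, 3592602003, 3592472979, 3592831304, 3532706199, 3532706120,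
    3531788616, 3584172584, 3584229798, 3584100774, 3584573785, 3583054248, 3583541584,
    3582495056, 3574667688, 3575169360, 3574122832, 3565736279, 3498486312, 3501539752,
    3493153192, 3517595991, 3498529190, 3501855056, 3493482832, 3498400166, 3500808528,
    3492436304, 3498758489, 3440468411, 3441099101, 3440052573, 2057847071, 3292090717,
    3436740893, 3428354333, 3291044189, 3369648413, 3361261853, 973787423],
  [3593749219, 3593749063, 3593734727, 3593748931, 3593749080, 3006546373, 3006532037,
    3592831576, 3005628869, 3005614533, 3006546402, 3584574045, 3114811847, 3114797511,
    3116646891, 3108389355, 3517596253, 2578072007, 2578057671, 2580824555, 2572567019,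
    3445113331, 2980856174, 2980841838, 1986281886, 1449542046],
  [3593749225, 3593749065, 3123987030, 3123872342, 3122840165, 3114467941, 3593749110,
    3593748946, 3123986926, 3123872238, 3122840073, 3114467849],
  [3593749226, 3593749066, 3593734743, 3593748933, 3534885463, 3534913989, 3006546394,
    3592602216, 3006546379, 3006546401, 2536669665, 3586409067, 3116646862, 3116632552,
    3116532201, 3123069445, 3520234091, 2580709838, 2580824553, 2580681192, 2593554949,
    3468968474, 1986281846, 1986281883, 1927446939, 3006546356],
  [3593749231, 3593749068, 3593734747, 3593748935, 3593634420, 3593634256, 3123986924,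
    3592602223, 3592602062, 3592817129, 3122037252, 3584229999, 3584229838, 3584559593,
    3113779716, 3105407498, 3392815744, 3392815572, 3392801265, 3392815470, 3520234013,
    2404663673, 2397323679, 3511861778, 2337685878, 2337671579, 2534719921, 3444769298,
    1800946038, 1800931739, 1997865393, 1464222135],
  [3593749232, 3593749069, 3593734748, 3593748936, 3593634419, 3123986897, 3123972586,
    3577922158, 3123069391, 3123055079, 3123986947, 3576889966, 3114811855, 3114797543,
    3116646915, 3105407496, 3520348802, 3520348627, 3520334322, 2404663662, 3520234006,
    2397323639, 2397309340, 3394421265, 2535866744, 2976268701, 2536784304, 3386049041,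
    1999126904, 2909290909, 2000961968, 1461240243],
  [3593749254, 3593749073, 3593749121, 3593748949, 3586294401, 3586294229, 3593749017,
    3593748855, 3511861889, 3511861717, 3534111257, 3534111095, 3591799323, 3591799158,
    3006546357, 3436511873, 3436511701, 3584573979, 3584573814, 3466101273, 3466101111,
    2940371381, 3369648667, 3369648502, 2873508280, 2805498296, 3368501889, 3368501717,
    3510256155, 3510255990, 3435823643, 3435823478, 2404663736, 3390751257, 3390751095,
    2337456565, 2267726264, 3316318745, 3316318583, 1796932024, 1733624245, 1195852213],
  [3593749269, 3593749149],
  [3593749270, 3593749094, 3593734757, 3593605733, 3592559205, 3114467996, 3593749157,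
    3593749004, 3593734665, 3593605641, 3592559113, 3114467885],
  [3593749271, 3593749095, 3593734759, 3593748962, 3532706407, 3593634273, 3593505249,
    3532692071, 3592602081, 3592473057, 3532706274, 3593749156, 3123986950, 3123972614,
    3593605642, 3592559114, 3532706468, 3533079050, 3532032522, 2593182214, 2593167878,
    3593749050, 3123986871, 3123972535, 2593182135, 2593167799],
  [3593749273, 3593749105, 3593734765, 3593748968, 3593605741, 3593634280, 3593505259,
    3592559265, 3592602123, 3592473092, 3591426564, 3584172707, 3584229894, 3584100869,
    3583054341, 3105364523, 3520105131, 3535028766, 3520104975, 2580810139, 3520090639,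
    2580681115, 2580580766, 3533838900, 2594357689, 2594572721, 2593526193, 3464782387,
    3584229815, 2055768500, 2055754164, 3105364416],
  [3593749274, 3593749100, 3586394732, 3593748973, 3593605746, 3593634279, 3586165223,
    3592559264, 3592602114, 3123055111, 3591426563, 3584058016, 3114811911, 3584100866,
    3582136835, 3108160042, 3520205484, 3534914067, 3468724755, 3593748895, 3520205340,
    2595389853, 2059438493, 3532921391, 2593440175, 3123055032, 2593182128, 3464782383,
    3114811832, 2055539119, 2055410096, 3108159935],
  [3593749275, 3593749104, 3593734768, 3593748975, 3593605749, 3593634282, 3593505258,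
    3592831650, 3123069442, 3123055106, 3593605640, 3584574114, 3114811906, 3114797570,
    3586265608, 3108389420, 3520348845, 3520348693, 3520334357, 2404663712, 3520205343,
    2404549020, 2404419996, 3534111281, 2536784303, 2536769967, 2595361203, 3467133489,
    2000961967, 2000947631, 2059538867, 3108389313],
  [3593749292, 3593749119, 3534097023, 3593748976, 3586265769, 3586294285, 3593505296,
    3593748892, 3511704233, 3533881872, 3511732749, 3534096796, 3591426613, 3123872182,
    2594228662, 3466732202, 3466789390, 3576760852, 3584573851, 3465613870, 3466101170,
    3116403125, 3397933616, 3577921969, 3397962159, 3113750972, 3392170666, 3517137428,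
    3392227854, 3510241691, 3457815088, 3457843631, 3520104881, 3389217326, 2572337589,
    3389704626, 2567592380, 3440468530, 3441099184, 3381217712, 2026967485, 1480808893, 1959559520],
  [3593749293, 3593749123, 3593734787, 3593748980, 3593605808, 3593634336, 3593505312,
    3593748897, 3592559279, 3592602135, 3592473111, 3592831390, 3593605687, 3006431666,
    3006302642, 3584172719, 3584229911, 3584100887, 3584573854, 3586265655, 2940371378,
    2940242354, 3398507062, 3575169459, 3574122931, 3123843518, 3517065903, 3517137431,
    3517008407, 3517596062, 3520205367, 2404549042, 2404420018, 3390134838, 3508191667,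
    3507145139, 2595361214, 3381748278, 3441099187, 3440052659, 2059538878, 3364559298, 957028705],
  [3593749294, 3593749124, 3593734788, 3593748981, 3593749166, 3593749016, 3593734680,
    3593748896, 3534111406, 3534111256, 3534096920, 3534111136, 3591426616, 3006546358,
    3006532022, 3467133614, 3467133464, 3467119128, 3467133344, 3583054392, 2940486070,
    2940471734, 3578151481, 3578151353, 3578137017, 3565736382, 3392815790, 3392815640,
    3392801304, 3392815520, 3520348729, 3520348601, 3520334265, 3507575352, 2337685942,
    2337671606, 3498744254, 3440468536, 1800946102, 1800931766, 3431637438, 3364415934, 2980856161],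
  [3593749363, 3593749210, 3593734874, 3593749062, 3593749222, 2984526408, 2984512072,
    3592831718, 2976268872, 2976254536, 3006546529, 3584574182, 2909291080, 2909276744,
    2940486241, 2873508449, 3517596390, 2372551240, 2372536904, 2404663905, 2337686113, 1800946273],
  [3593749365, 3593749211, 3123987172, 3123872491, 3122840299, 3114812145, 3535028985,
    2595504720, 2536784480, 2536784504, 2535867000, 3114812046],
  [3593749367, 3593749212, 3593734885, 3593749064, 3468853997, 3006546507, 2984526425,
    3592831741, 3005629007, 3005614687, 3006546554, 3584574196, 2940486222, 2940486238,
    2000847479, 3108389510, 3517596404, 2404663886, 2404663902, 1934787191, 2572567174,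
    2059682444, 2973516322],
  [3593749375, 3593749214, 3123987186, 3123872498, 3105407730, 3105293042, 3593749260,
    3593749076, 3123987088, 3123872400, 3105407632, 3105292944],
  [3593749376, 3593749215, 3593749238, 3593749071, 3534914294, 3534914127, 3006546556,
    3592602363, 3592602190, 3005629049, 2534834809, 3576890119, 3114811986, 3114812039,
    3116532362, 3105407627, 3501540103, 2577039954, 2580824714, 2577040007, 2561327755,
    3367699094, 1986281942, 2922136097, 2392621601, 1187824163],
  [3593749377, 3593749216, 3593749246, 3593749072, 3593634558, 3593634384, 3006546558,
    3592602366, 3592602192, 3005629054, 3004596862, 3584230155, 3584229971, 3114812047,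
    3113779855, 3105407631, 3517137675, 3517137491, 2578072207, 2577040015, 2568667791,
    3441099418, 1800946135, 1791771173, 1724678693, 1187824165],
  [3593749392, 3593749280],
  [3593749393, 3593749228, 3593734891, 3593605867, 3122840344, 3116647197, 3534785316,
    3593749118, 2595261048, 2595246712, 2536540839, 3116647100],
  [3593749395, 3593749230, 3586394862, 3593749081, 3520205550, 3534914137, 3468724825,
    3593749287, 3006546557, 3123972729, 2595361401, 3586394919, 3116647033, 2940471933,
    2059424377, 3123987128, 3520205607, 2580710009, 2052098681, 2404520573, 2595390136,
    2059438776, 2984526403],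
  [3593749398, 3593749235, 3593734898, 3123872542, 3122840348, 3114468124, 3593749303,
    3593749141, 3593734800, 3123872450, 3122840253, 3114468029],
  [3593749399, 3593749233, 3593734897, 3593605919, 3592559389, 3584172829, 3593749309,
    3593749134, 3593734798, 3593605827, 3592559292, 3584172732],
  [3593749400, 3593749240, 3593734903, 3593749087, 3534885665, 3534914171, 3123972732,
    3592602403, 3123069565, 3123055223, 2536669862, 3584559922, 3116647049, 3114797701,
    3116532404, 3108031157, 3520348976, 2580824712, 3520334475, 2580681394, 2594357946,
    3467119302, 1986282017, 1999112739, 1927447099, 2858814014],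
  [3593749401, 3593749237, 3534097141, 3593749086, 3593605922, 3593634426, 3534785145,
    3533724450, 3592602233, 3533752954, 3591426726, 3584574255, 3584574088, 3584559754,
    3116503731, 3108160187, 3510242095, 3510256266, 3510241928, 2580581051, 2572180147,
    3445113550, 1800946209, 1330252321, 1986282044, 1390807612],
  [3593749402, 3593749244, 3535014652, 3593749088, 3593605926, 3593634424, 3534785144,
    3592559398, 3592602232, 3533752952, 3591426727, 3584574262, 3584574099, 3584559759,
    3116532406, 3108160182, 3517582134, 3517596303, 3517581971, 2580581046, 2572208822,
    3445113554, 1800946213, 1800014373, 1986282052, 1449542212],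
  [3593749403, 3593749242, 3593734906, 3593749089, 3593605925, 3593634423, 3593505399,
    3592559397, 3592602231, 3592473207, 3532706472, 3584574271, 3114812049, 3114797713,
    3116647097, 3108389561, 3517596478, 3517596300, 3517581964, 2595361471, 2594314943,
    3445113552, 1793606178, 1793591842, 2000962114, 1464222274],
  [3593749404, 3593749247, 3593734911, 3593749090, 3593749288, 3006546555, 3006532219,
    3592831784, 3005629051, 3005614715, 3006546600, 3584574268, 3114812045, 3114797709,
    3116647095, 3108389559, 3517596476, 2578072205, 2578057869, 2580824759, 2572567223,
    3445113556, 2980856356, 2980842020, 1986282047, 1449542207],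
  [3593749429, 3593749257, 3593734968, 3593749138, 3593605945, 3593634449, 3123972801,
    3577879348, 3577922181, 3123055281, 3591770805, 3576832820, 3576889989, 3114797745,
    3583513269, 3574667959, 3517596500, 3517596312, 3520334540, 2404663844, 3520205515,
    2404549154, 2397309504, 3368688325, 1522713123, 2976268861, 2593526334, 3367641797,
    1521680931, 2909291069, 2056786494, 1490098751],
  [3593749431, 3593749258, 3593734971, 3593749133, 3569750842, 3593634452, 3123987136,
    3591641907, 3592602249, 3592817332, 3569406641, 3583255347, 3584230025, 3584559796,
    3568374449, 3567327929, 3392815957, 3392815767, 3392801485, 3392815652, 3569750735,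
    3593634341, 2397323841, 3500808904, 2572337697, 2337671739, 985715261, 3433702088, 2035483169,
    1800931899, 984683069, 983636546],
  [3593749430, 3593749256, 3593734965, 3593749127, 3586265909, 3586294407, 3593505470,
    3592559409, 3592602246, 3592473266, 3591426739, 3583255345, 3583312518, 3584101043,
    3583054514, 3574667960, 3368502099, 3368501913, 3510241991, 3510256161, 3435795143,
    3435823649, 3593505345, 3390708420, 3390751266, 2572180027, 2564037180, 3316261572,
    3316318754, 2035425852, 2026938939, 1196999235],
  [3593749471, 3593749334, 3534097238, 3593749193, 3466072918, 3586294473, 3593505482,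
    3593749056, 3389676374, 3533882058, 3511732937, 3534096960, 3569406673, 3591799355,
    3531917883, 3314197334, 3465872074, 3576761041, 3584574011, 3436253897, 3466072640,
    3464696379, 3239779018, 3575169604, 3361233467, 3294011963, 3239635798, 3517137617,
    3389475530, 3510241851, 3314111178, 3435795003, 3515517508, 3359857353, 3390134843,
    3389676096, 3234130491, 3291833033, 3315687995, 3241355835, 3314197056, 3239635520],
  [3593749488, 3593749335, 3593734999, 3593749205, 3593605975, 3593634517, 3593505493,
    3593749061, 3364559703, 3592602323, 3592473299, 3592831551, 3591426771, 3591799359,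
    3590752831, 3364545367, 3584230099, 3584101075, 3584574015, 3583054547, 3583541823,
    3582495295, 3364559573, 3369146943, 3360889407, 3293911615, 3364416343, 3517137619,
    3517008595, 3517596223, 3515962067, 3516564031, 3515517503, 3364444885, 3368114751,
    3359857215, 3292879423, 3364315861, 3367068223, 3358810687, 3291832895, 3364559429],
  [3593749492, 3593749358, 3123987316, 3123987321, 3123069817, 3114812281, 3517596541,
    2372551389, 2371633895, 2397324033, 2330346241, 1793606401],
  [3593749493, 3593749359, 3006546806, 3006432118, 3005399926, 3123987333, 2595505029, 3006546708],
  [3593749494, 3593749360, 3123987320, 3116532600, 3122840450, 3113550722, 3520349066,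
    2404664033, 2397324032, 1927447296, 2535867149, 1998095117],
  [3593749497, 3593749361, 3593749372, 3593749213, 3468854153, 3006546658, 2984526594,
    3401761673, 3005629154, 2976269058, 3006546705, 3584230283, 3114812129, 2909291267,
    2000847630, 1463993102, 3517137803, 2578072289, 2372551427, 1934787342, 1397932814, 1796932370],
  [3593749504, 3593749413],
  [3593749505, 3593749366, 3535014774, 3006546834, 3005629330, 3123987360, 2595490720, 3006546766],
  [3593749506, 3593749370, 3593735032, 3123872660, 3123069855, 3114812318, 3520334761,
    2595504899, 2404649728, 2397309737, 2535867201, 2000948032],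
  [3593749507, 3593749369, 3593735033, 3593606037, 3123987363, 3116647331, 3520349103,
    2404664065, 2404649729, 2404664107, 2536784717, 2000962381],
  [3593749510, 3593749371, 3592817531, 3593749223, 3593749421, 3006546692, 3006532354,
    3592817581, 3005629186, 3005614852, 3006546768, 3584574380, 3114812160, 3107457792,
    2940486466, 2873494338, 3517596588, 2578072320, 2570717952, 2404664130, 2337672002, 1800946511],
  [3593749511, 3593749374, 3593735038, 3593749224, 3593749424, 2984526597, 2984512261,
    3592831920, 2976269061, 2976254725, 3006546770, 3584574384, 2909291269, 2909276933,
    2940486482, 2873508690, 3517596592, 2372551429, 2372537093, 2404664146, 2337686354, 1800946514],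
  [3593749517, 3593749437],
  [3593749518, 3593749378, 3593735073, 3593606047, 3592559518, 3114812346, 3534914495,
    2595390221, 2595490633, 2595361601, 2593440576, 3114812253],
  [3593749519, 3593749380, 3593735069, 3593606045, 3122840482, 3105293240, 3593749449,
    3593749266, 2595490627, 2595361603, 3122840399, 3105293150],
  [3593749520, 3593749379, 3123987364, 3123872669, 3122840477, 3114812345, 3535029192,
    2595504915, 2536784721, 2536670019, 2535637827, 3114812258],
  [3593749521, 3593749381, 3593735072, 3593606048, 3592559520, 3584230332, 3535029201,
    3535029012, 2595504974, 2595390286, 2594358094, 3584230249],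
  [3593749525, 3593749382, 3593735078, 3593749249, 3586266023, 3593634560, 3123972905,
    3533882307, 3533882128, 3005629256, 2534835012, 3584230337, 3584230158, 3114797890,
    3466072901, 3108160345, 3516220352, 3516220173, 3517582144, 3457815363, 2568667992,
    2027225951, 2325529302],
  [3593749526, 3593749384, 3593735086, 3593749253, 3468854187, 3468854020, 2984526634,
    3592831942, 3005629200, 3005614923, 3006432069, 3584574398, 2940486415, 2940486476,
    2000847687, 3108389723, 3517596606, 2404664079, 2404664140, 1934787399, 2572567387,
    2059682659, 2973516503],
  [3593749527, 3593749383, 3586395048, 3593749250, 3520205736, 3534914306, 3468725034,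
    3592602571, 3592602383, 3005629254, 2534835014, 3584574402, 3114812174, 2940472138,
    2059539268, 3105407834, 3516564418, 2577040142, 2052328260, 2404520778, 2561327962,
    2059682661, 1187824344],
  [3593749528, 3593749388, 3468954538, 3593749251, 3468825514, 3593634563, 3468725035,
    3592602576, 3592602387, 3592831817, 3591799625, 3584230348, 3584230161, 3467119428,
    3466072900, 3105407840, 3517137868, 3517137681, 3458861892, 3457815364, 2568668000,
    2035827559, 1187824345],
  [3593749556, 3593749435, 3593735096, 3593606072, 3574668217, 3574653881, 3593749474,
    3593749352, 3593735006, 3593605982, 3574668130, 3574653794],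
  [3593749557, 3593749450, 3593735108, 3593749323, 3534885828, 3534914379, 3593505608,
    3592559559, 3592602442, 3592473410, 3532706626, 3576718319, 3116647260, 3114797921,
    3586265946, 3573750619, 3501239279, 2580710236, 3520334682, 2577011553, 3498400603,
    3239535466, 1986282198, 1999112920, 1931088600, 3239779031],
  [3593749559, 3593749445, 3534097349, 3593749324, 3591427013, 3593634640, 3534785350,
    3531774917, 3592602438, 3533753168, 3591426892, 3583255520, 3584230236, 3584559961,
    3565622108, 3565722457, 3506858976, 3510256473, 3509668700, 3491418969, 3491060572,
    3433128812, 1800946390, 1330252502, 593023702, 122329814],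
  [3593749558, 3593749454, 3535014862, 3593749329, 3593606093, 3593634625, 3534785345,
    3592559565, 3592602433, 3533753153, 3591426893, 3568575457, 3584230244, 3584559968,
    3568374616, 3567328088, 3493096417, 3517596512, 3517008740, 3493024600, 3491978072,
    3291833195, 1800946393, 1800014553, 3292205782, 3291159254],
  [3593749560, 3593749455, 3593735119, 3593749330, 3532706767, 3593634631, 3593505607,
    3532692431, 3592602439, 3592473415, 3532706642, 3584173027, 3114812262, 3114797926,
    3565736803, 3565722467, 3498486755, 3517596515, 3517582179, 2559234918, 2559220582,
    3440468845, 1793606359, 1793592023, 577426135, 577411799],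
  [3593749587, 3593749489, 3006546931, 3006432247, 3005400055, 3114812410, 2578072570, 1791771534],
  [3593749589, 3593749490, 3123987451, 3116532731, 3108160507, 3098870779, 3517137919,
    2404664178, 2511094669, 1981580173, 1444725645, 900531085],
  [3593749592, 3593749516],
  [3593749593, 3593749491, 3535014899, 3006546948, 3005629444, 3114812425, 2578058249, 1791771570],
  [3593749595, 2595505172],
  [3593749596, 3593749538],
  [3593749597, 3593749495, 3535014917, 3123872772, 3005629458, 3116532764, 2580825115, 1986167763],
  [3593749598, 3593749496, 3006546949, 3006432261, 3005400083, 3123987488, 2595505184, 2984526810],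
  [3593749600, 3593749500, 3123987464, 3116532761, 3122840605, 3114468378, 3520349224,
    2404664205, 2397324209, 1927447508, 2506507218, 2909291477],
  [3593749601, 3593749498, 3593735177, 3593634853, 3592602651, 3584230427, 3517596713,
    2401911694, 2372551602, 2404664283, 2337686483, 1800946643],
  [3593749602, 3593749499, 3593735178, 3123987487, 3123069983, 3114812451, 3517596714,
    2578072461, 2372551603, 2397324246, 2330346454, 1793606620],
  [3593749603, 3593749501, 3123987467, 3123987489, 3123069985, 3114812449, 3517596721,
    2372551567, 2371634100, 2397324249, 2330346457, 1793606617],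
  [3593749611, 3593749502, 3593749552, 3593749391, 3468854315, 3468854158, 2984526807,
    3401761835, 3401761678, 2976269271, 3004597210, 3584230444, 3584230285, 2909291480,
    1998095314, 1461240786, 3517137964, 3517137805, 2372551640, 1931117522, 1394262994, 1796932573],
  [3593749617, 3593749566],
  [3593749618, 3593749523, 3535014931, 3593606162, 3592559634, 3123987515, 2595490875, 3006546922],
  [3593749619, 3593749524, 3593735188, 3593606164, 3592559636, 3593749567, 3535029311, 3593749486],
  [3593749620, 3593749534, 3593735193, 3586266141, 3122840633, 3114468410, 3520334912,
    2595505112, 2404649940, 2052084690, 2535867364, 2000718821],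
  [3593749621, 3593749540, 3593735194, 3586266138, 3592559673, 3583255609, 3520105540,
    3593749468, 2595490773, 2059539413, 2594200548, 2056299492],
  [3593749622, 3593749532, 3593735196, 3586266144, 3592559676, 3583026235, 3520349251,
    2580825043, 2580810707, 3461485530, 2594315243, 2056328170],
  [3593749623, 3593749537, 3593735201, 3593606182, 3121665085, 3113292861, 3520349258,
    2404664281, 2404649945, 3593606109, 2536784873, 2000962537],
  [3593749628, 3593749543, 3586395175, 3593749426, 3520205895, 3534914519, 3468725207,
    3577879617, 3592602580, 3123055574, 2534835175, 3576718401, 3114812374, 3584101332,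
    1997048807, 3398507496, 3517066310, 3517137875, 3458288595, 2404520940, 3390135268, 3380831204],
  [3593749629, 3593749550, 3445099566, 3593749425, 3593606210, 3593634777, 3468725202,
    3533839426, 3533882329, 3394292690, 3004597229, 3444597826, 3584230354, 3444640729,
    3583054822, 3574668261, 3384831042, 3509797842, 3384888281, 3515962341, 3507575782, 1795886061],
  [3593749630, 3593749549, 3592817709, 3593749428, 3468854345, 3006546910, 3006532567,
    3401632841, 3005629399, 3005615070, 3006546920, 3584574536, 3114812372, 3107458004,
    2000847846, 1463864294, 3517596744, 2578072532, 2570718164, 1934787558, 1397804006, 3440468969],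
  [3593749631, 3593749551, 3445099567, 3593749427, 3468825669, 3593634776, 3468725211,
    3401718853, 3592602584, 3401632731, 3591799787, 3584058437, 3584230363, 3444640728,
    3465614311, 3398507495, 3516951621, 3517137883, 3443608536, 3457242087, 3390135271, 3440053227],
  [3593749652, 3593749586, 2984526932, 2984412244, 3005400150, 2938307670, 2401453142],
  [3593749654, 2595505255],
  [3593749655, 3593749588, 3006547034, 2984526943, 3005629541, 2938651748, 2401911908],
  [3593749657, 3593749616],
  [3593749658, 3593749590, 3123987561, 3123872868, 3122840676, 3098870893, 2578072686, 900531250],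
  [3593749659, 3593749591, 3006547048, 3006432358, 3005400166, 3114812524, 2578072684, 1791771699],
  [3593749663],
  [3593749664, 2595505275],
  [3593749665, 3593749599, 3535015007, 3468825695, 3006547065, 2940372089, 2404420729],
  [3593749666, 3593749639],
  [3593749667, 3593749643],
  [3593749668, 3593749605, 3593735268, 3534886010, 3122840697, 3114812544, 2580825220, 1967932491],
  [3593749669, 3593749606, 3534097510, 3123872888, 2594229368, 3114812545, 2570718337, 2980856908],
  [3593749670, 3593749610, 3593735273, 3006432378, 3005400186, 3114812546, 2578072706, 2980856909],
  [3593749671, 3593749608, 3535015016, 3006547064, 3005629560, 3114812549, 2578058373, 1791771726],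
  [3593749672, 3593749607, 3593735271, 3593606267, 3592559739, 3584574602, 3517596810, 1800946769],
  [3593749678, 3593749615, 3123987590, 3116532870, 3122840707, 3113550979, 3520349326,
    2404664370, 2397324367, 1927447631, 2330117196, 1726284876],
  [3593749677, 3593749612, 3593735301, 3593606281, 3569622145, 3568575617, 3392357517,
    2401911859, 2372551758, 2404549709, 1511703628, 1503331404],
  [3593749676, 3593749613, 3593735304, 3586266240, 3577879680, 3584173186, 3517138060,
    2578072626, 2372551760, 1934787659, 1397933131, 3316261965],
  [3593749686, 3593749647, 3586395279, 3593749582, 3520205967, 3534914638, 3468725326,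
    3364560015, 3592602703, 3577793611, 3503346763, 3357205647, 3576890443, 3584101455,
    3427996747, 3364559950, 3291016335, 3501540427, 3427093579, 3515962447, 3305725006, 3239535694],
  [3593749687, 3593749648, 3445099664, 3593749584, 3436713104, 3593634896, 3468725329,
    3369606288, 3592602704, 3401632849, 3334526033, 3560203408, 3584230481, 3444640848,
    3436254288, 3369147472, 3493096592, 3517138001, 3443608656, 3435222096, 3368115280, 3248710737],
  [3593749692, 3593749651, 2980856981, 2979824789, 2971452565, 2904360085, 2367505557],
  [3593749693, 2404664478],
  [3593749694, 3593749653, 2984527000, 2984412317, 2976269468, 2909291676, 2372551836],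
  [3593749696],
  [3593749697, 2404664490],
  [3593749698, 3593749656, 3445099672, 2984527017, 2976269481, 1793592489, 1785334953],
  [3593749699, 2595505329],
  [3593749700, 2595505331],
  [3593749701, 3593749660, 3535015081, 3468825769, 3122840751, 3113551023, 2404664500],
  [3593749702, 3593749661, 3006547115, 3006432425, 3005400240, 2938651823, 2401911983],
  [3593749703, 3593749662, 3123987626, 3123872938, 3122840754, 3114468530, 3517138097],
  [3593749706, 3593749691],
  [3593749707, 3593749680, 3534097584, 3593606319, 3533724847, 3113551032, 2567392440, 1959560337],
  [3593749708, 3593749685, 3593735346, 3593606322, 3592559794, 3114468537, 2577614009, 2980283538],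
  [3593749709, 3593749683, 3593735347, 3591427251, 3591412915, 3584173242, 3517066426, 1800946834],
  [3593749713, 2367505599],
  [3593749714],
  [3593749715, 2372551880],
  [3593749716, 3593749695, 2984527049, 2984412361, 3005400264, 2938307784, 2401453256],
  [3593749717],
  [3593749718, 2404664526],
  [3593749719, 2595505360],
  [3593749720, 3593749704, 3535015112, 3468825807, 3401718991, 3114468558, 2577485006],
  [3593749721, 3593749705, 3445099721, 2984527055, 2976269519, 1793592527, 1785334991],
  [3593749723],
  [3593749724],
  [3593749725],
  [3593749726, 2372551898],
  [3593749727, 3593749722, 3535015130, 3468825818, 3401719002, 3333694682, 3258215642],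
  [3593749728],
  [3593749729],
  [3593749730],
  [3593749731]]

set_option maxRecDepth 20000 in
/-- For each graph in the catalogue, a number with the signs and the vectors of `matrixCheck`, and a
number with the forces of `forcingCheck`. -/
def certificates : List (ℕ × ℕ) := [
  (0, 0), (0, 0), (641, 8), (0, 0), (2625, 17), (158275, 656), (2689, 16), (0, 0), (10561, 26),
  (1600067, 1241), (174723, 1672), (10817, 25), (1059457, 1240), (642360711, 46736),
  (1714819, 1112), (436611, 1616), (1354371, 664), (10881, 24), (0, 0), (42305, 35),
  (9804099, 1826), (43342403, 2257), (43329, 34), (27896385, 1825), (9229134407, 84185),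
  (43307919687, 116872), (27372099, 1697), (6923843, 2201), (33581697, 1824),
  (11451787907, 84056), (28744765253967, 3000464), (22718787, 2184), (44410435, 1249),
  (40343278983, 50848), (40359078215, 79960), (35070175879, 108616), (10227456583, 115360),
  (18966997383, 140880), (43585, 33), (45409200519, 79456), (21879957063, 47248), (5941571, 1696),
  (6083225927, 79960), (27957889, 1248), (33712771, 1632), (37792385, 1248), (43513436743, 46752),
  (23243331, 2128), (44587651, 1120), (10135937, 1632), (22588035, 672), (43649, 32), (0, 0),
  (169281, 44), (307668291, 2411), (693463363, 2842), (173377, 43), (269920577, 2410),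
  (2548095686983, 121634), (1487540757831, 154321), (177526712647, 181896), (710302019, 2282),
  (110532931, 2786), (537307713, 2409), (2926372563267, 121505), (9083651373754959, 5397209),
  (710236739, 2769), (2204837959299, 154248), (5230749034125647, 7784584),
  (7143899190945103, 7654048), (39229763, 1834), (2578764356167, 88297), (705555749191, 117409),
  (658294335815, 152809), (1822310160967, 146065), (1418523482439, 178329), (447392385, 2408),
  (2476428400003, 121440), (1832347025974599, 7654048), (12009027485149831, 5651032),
  (11986352223136071, 5683288), (384036066951, 146056), (20860700246698796703, 192333968),
  (1469589052039, 176784), (452404615495, 178312), (174401, 42), (109075408199, 116905),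
  (2909464258119, 84697), (710302275, 2281), (705551558983, 117409), (648391233, 1833),
  (732566039171, 88296), (4884057937041743, 5622368), (11688517837428111, 5683288),
  (2841509029914959, 3553936), (10859144611732047, 3548392), (9730821940746831, 7514192),
  (2612548722923151, 7686752), (1559187583052367, 3525280), (177629827, 121632),
  (652997207367, 117384), (7435602633315727, 9348168), (10720892566477455, 9779784),
  (7478365419841167, 4608744), (6298626541905295, 11413072), (710236803, 2768), (177624643, 2217),
  (178678337, 1833), (590107535943, 84201), (680880707, 2713), (1507040764008783, 3524776),
  (1451519239350671, 3525280), (10527313277397391, 5388888), (1144619968835, 80232),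
  (11349715524622927, 3000976), (2796163, 2696), (346455104135, 144488),
  (10597253614507663, 7475880), (1238605600135, 117344), (10525997025109327, 7481928),
  (456787383683, 116840), (7195558035171727, 5421144), (1695465628587663, 5420616),
  (99662944688719, 5556952), (2750194297411, 84568), (384840148615, 146000),
  (10593400841726351, 7514192), (7042548447749711, 7686752), (2652588627587, 117344),
  (560670861959, 121632), (713386563, 1705), (575052353, 2217), (367310317895, 55464),
  (2376346539655, 109152), (457727186307, 116840), (5780785825229455, 5387880),
  (5102977414769295, 3525280), (1556931586691, 84568), (1235892024289679, 3525264),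
  (353799612807, 140392), (1521581992263, 140904), (1825451977095, 141896),
  (104159946119, 173640), (2570577156423, 116904), (2476361291395, 117344), (402811521, 1832),
  (10208558858266959, 5388888), (1707067574675791, 5374185), (1803910027587, 84200),
  (2909394282823, 80232), (1212951995783, 174168), (1447410583099791, 3324056),
  (2788868844103, 173648), (2295267158407, 51864), (711371075, 1257), (1547440641415, 108648),
  (157447267975, 80472), (663125403203, 140904), (355031754311, 117408), (177861908103, 109128),
  (671197825, 1832), (2542917035395, 84072), (2501308163463, 84576), (2832515104942479, 3524776),
  (271231619, 2216), (2891679701639, 109152), (7178305184900495, 3525280), (2845052148103, 51864),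
  (2749989824903, 109152), (1380989708679, 50856), (2375690132039, 141904), (35704711559, 140392),
  (113017267847, 140904), (45543483015, 174168), (44214913, 2648), (174657, 41),
  (726393006471, 79976), (1484624583239, 47760), (2291945346631, 50856), (1262727375175, 79976),
  (728422831751, 51864), (705878448775, 115368), (2920890608007, 108648), (75590444679, 84704),
  (79753030023, 80472), (1673250908743, 80480), (2891696989831, 140904), (694248106311, 117408),
  (336243265, 2648), (560638275, 1704), (446868099, 2152), (294919710343, 79464),
  (369374177671, 47272), (713382531, 2640), (713124483, 1704), (1805248014983, 79976),
  (111843969, 2411), (2784658826823, 56096), (378186307, 2648), (336243331, 1640),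
  (682191489, 1256), (2789755757959, 46760), (621455937, 2152), (575314561, 2656),
  (715564419, 1128), (681667201, 1640), (1747523, 680), (174721, 40), (0, 0), (677185, 53),
  (4921660739, 2996), (11095352643, 3427), (693569, 52), (7136257345, 2995),
  (72939371603271, 159083), (41052997511495, 191770), (6207995271751, 219345),
  (11364033859, 2867), (10223248707, 3371), (8595614017, 2994), (99594224118083, 158954),
  (2595508344816572751, 7793954), (11280230723, 3354), (187628508502595, 191697),
  (726493117516765775, 10181329), (655583080493766991, 10050793), (2762209151212148367, 12273288),
  (11296679235, 2419), (186179741374791, 125746), (45167593219399, 154858),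
  (164465460487495, 190258), (184815300732231, 183514), (112245301745991, 215778),
  (11451935297, 2993), (82068949849667, 158889), (1624010862465014087, 10050793),
  (1153362707896511047, 8047777), (2997539616968825159, 8080033), (24561396832839, 183505),
  (21403217970873385790047, 345725657), (185021446318407, 214233), (177387897005383, 215761),
  (70460375738691, 191624), (767025359230773575, 10173064), (2885200430630590087, 10017960),
  (29980758171808266888607, 517261984), (1623645149094463842655, 498813064),
  (186184047618695, 214664), (697665, 51), (6962248587591, 154354), (9992649664839, 122146),
  (8763386179, 2866), (9436720159047, 154858), (9669355841, 2418), (143641064150339, 125745),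
  (388903062654772559, 8019113), (1610363792604420431, 8080033), (2711493897184959055, 5950681),
  (2996465591740094031, 5945137), (1556294475085158735, 9910937), (2780274123045492303, 10083497),
  (164542723761475, 159081), (2474066179796658511, 5922025), (1806459116103, 154833),
  (46621038541887055, 7005489), (1623858296317961551, 12176529), (2311848146761324879, 11744913),
  (1748881432435660111, 13809817), (11276036675, 3353), (2863311489, 2992),
  (187626005375555, 158824), (2594395956026387015, 10017960), (2642015023205602887, 8071776),
  (72199802106309255, 8047712), (744665691887065743, 8047752),
  (7162279692881533229391, 509037152), (2708256664604464783, 9910920),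
  (2784722830580164931, 8019112), (50369489000973140929167, 382908504),
  (31479771277970787445391, 380779608), (2694653828655650127, 11582616),
  (381281676469642575, 12176520), (3027991699267430735, 11744904),
  (10059553590282777422223, 364591192), (23818434861699, 92912),
  (89655388120715825613724095, 12309973136), (1533097532817320271, 13678224),
  (1910689139407628687, 13808272), (2473999110662154575, 13809800), (10038715715, 2802),
  (1784326465, 2418), (35555389303111, 121650), (11347323203, 3298),
  (2996324862510404943, 5921521), (325756186858711631, 5922025), (151153252306167375, 7785633),
  (17620259940931, 117681), (169175835479464527, 5397721), (11430877763, 3281),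
  (143579319719495, 181937), (405783104282007887, 9872625), (24834127320647, 154793),
  (2688940713505876559, 9878673), (29232983353667, 154289), (3033615339794094415, 7817889),
  (367343082273413455, 7953697), (1608214237662583375, 7817361), (7312803981891, 122017),
  (164542899725895, 183449), (2775723311799900495, 9910937), (169967233706307, 154793),
  (118670386192079439, 10083497), (41396662262343, 159081), (29320220879491, 125744),
  (1560806580023814727, 8019048), (2377901978273081987, 8019112),
  (11328901804848395413151, 506907808), (2306486591449294215, 5950552),
  (2306010500478446215, 5945136), (31084013937876592580959, 379009624),
  (30724575105209551460959, 378977368), (23785442268559153194335, 378395752),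
  (114112905920289103, 9878664), (3074358295077169799, 5913960), (2785846156169947715, 5921896),
  (98965754914115, 146352), (44906977549144253949599, 230280352),
  (21344349107818733132127, 364066904), (385643345686980935, 7817888),
  (1552239944476027535, 7817352), (21622488946935448820127, 246271120),
  (50329209394902994348703, 246625936), (40325348335334161033887, 246261040),
  (6537809525112462207647, 192597136), (165487864015495, 183432),
  (45241957495956635757151, 645343824), (19213534097598170441055, 634235472),
  (6573482349724242957727, 634299984), (666684591981615751, 10181200),
  (30215922537633449400735, 328850536), (29627889510084240829087, 228244624),
  (39427200370378938160799, 244790952), (1849451768494516871, 8079720),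
  (671203842123475271, 5139816), (3049118464417032527, 9910920), (2997328391525014159, 9908880),
  (11727760894595, 154760), (5209343420970726675871, 489350448),
  (23659539426363766891871, 448351304), (21299438181326420354463, 777205320),
  (6392536067637649173151, 751674440), (162773444684423, 181872),
  (1948898227936463251039, 883828304), (94185031636295, 215760), (375039299, 2290),
  (1784325441, 2802), (23734015927879, 92913), (76307230185799, 146601),
  (140765046396483, 154289), (758120502850573903, 7784625), (2923295915111787087, 5922025),
  (158358213929539, 122017), (3067252159463200335, 5922009), (46550366906951, 177841),
  (185084809926215, 178353), (116714295089735, 179345), (182822335310407, 211089),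
  (42144993204807, 154353), (17620448750147, 154793), (10739165761, 2417),
  (2713816886253611343, 7785633), (2739618584565802575, 7770930), (162754742363459, 121649),
  (23805482673479, 117681), (97191257089351, 211617), (98434629146183, 211097),
  (2977269226703332943, 5720801), (41323115226439, 89313), (2377938358608700743, 5921520),
  (732151949416834435, 5921896), (393840096415549400735, 376884320), (45806520015491, 117680),
  (40607653381958621615711, 376916576), (2479979355256298119, 8019112),
  (24303966617173475547807, 211205272), (2984244253441809031, 5946456), (164462915659399, 179336),
  (2711564254336870991, 3851952), (2712760537754261135, 9809000),
  (43172683325679458756191, 244753648), (6299727558047196408479, 244759696),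
  (1344646927352506951, 3824304), (48577557945026400135775, 244790952),
  (31378300687968094557855, 228244624), (46841971509406287, 3566760),
  (1443696726553023879, 3824808), (170051355956867, 154760), (38392454448973692425631, 497634400),
  (38122099474574560634271, 498216016), (392382408281336403359, 498280528),
  (26093578302675781053023, 509004896), (42982149464014799415711, 242666656),
  (1596901114691364167, 7531600), (1227835674450045583, 7809632), (118332263267735175, 7777376),
  (2475438370577885511, 5433584), (1522287765971692175, 7785608), (1301549460292527751, 7777568),
  (2712751738706089551, 8079968), (1556739227543836999, 7687088), (327250211089586503, 3787440),
  (44143140848581374224799, 211237528), (43693014007795902223967, 192366736),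
  (28732143158394099505759, 366131288), (1153085429186468487, 5434584),
  (108460940752938375, 5716056), (93916310968647, 211080), (94117071332679, 209552),
  (3044809803490040399, 8045232), (1560076614711547535, 11643976),
  (44080395771409740491359, 631837424), (12198294899306875414879, 631848008),
  (6247219286104776202655, 632235080), (3051225472289040719, 9906760),
  (3026707092916054607, 9905768), (2400735648737305999, 9380968),
  (38970630795785959795359, 643207920), (2784461677772035463, 5921520),
  (1243738598416951887, 4647152), (2347618208739388047, 5922024), (189174628060124807, 9874504),
  (37877094116527458130527, 500344904), (47612942846075213339231, 500343904),
  (21939542291728059505055, 372722400), (44278070193329597471391, 500311112),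
  (1831017102788109711, 8084064), (11850182475653828945567, 499731040),
  (6643864441813631411551, 175725856), (416860660827360225631, 509036616),
  (405718164021286471, 7809632), (2889527854742739591, 7809632), (433776417991906951, 7515208),
  (3028952950373001615, 11740752), (2742791445139839631, 12111000),
  (9492031482134449007263, 645343824), (11105525849502496745887, 634299984),
  (1826379053169027471, 10181200), (1767142246299626119, 9809000), (1730900705363470663, 9906768),
  (406899934472066703, 8079720), (182530115016007, 154832), (5676640579, 1842),
  (35830053054791, 146097), (180750101666119, 117921), (140760734652995, 178353),
  (1265276394055, 154857), (187008590129479, 146577), (6444198465, 2417),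
  (162754121329219, 121521), (107083841824071, 122025), (2704703652904987215, 5921521),
  (7115287107, 2801), (187282478487879, 146601), (2477411175505503823, 5922025),
  (7037934786887, 89313), (111216724433223, 146601), (152104464636487, 88305),
  (92799816346183, 177841), (1810959591751, 178353), (107779672664647, 179353),
  (147766380177735, 211617), (706390593, 3233), (46905897429635, 92912),
  (668385862871570831, 5913704), (1320260945136146767, 7547488), (2496149310344353351, 3824304),
  (2306218258722302535, 3824808), (28977964670744422047, 242665648),
  (31015203199682223647135, 240278760), (1802743189470865799, 7777376),
  (1252080507985439047, 5401328), (596657313613484823967, 226151584),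
  (1486366553664018055, 7654560), (44444732938611619109535, 378977368),
  (384682037192599119, 3847856), (3031318812573673871, 3848368), (389185705594148239, 3849360),
  (9561489445890309056159, 379009624), (21951718376592501025183, 224054488),
  (1226832216530971023, 9284712), (388793244381259087, 9382480), (2305872328981322055, 5885288),
  (2691325556420880719, 9780328), (29363145845400967, 5716056), (1337720986594355599, 5651560),
  (93910573164871, 146568), (9850636357936582665567, 192334992), (385344305379304847, 11414608),
  (2691276373625578831, 11381840), (478655506061568399, 3843888), (23649543955779, 179344),
  (106113979229827, 179336), (443675663798020751, 9876592), (2882344582306704007, 5921520),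
  (1891531663067424143, 5922024), (1153373019847677319, 9874504), (82061432345987, 154224),
  (39367986530656653502879, 498209456), (7389688947337233586847, 497338544),
  (690499445481641615, 7777376), (1159134124713874831, 7785568),
  (39646971667730910517663, 498216008), (623751119373702535, 7784560),
  (1200676208022021455, 7529584), (43850803743598811900511, 379009608),
  (30714513731548613352031, 513221736), (40235381552727887287903, 173694184),
  (5096203981766615542367, 344251624), (1560876990638746183, 7809632),
  (437013699919254919, 7809632), (2342156186845549967, 7498856), (1513360531390830215, 7740584),
  (2786134610401469767, 5922024), (407858798806854215, 7809096), (175945036769859, 121952),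
  (103223913468473813663, 379008584), (39720535277302544246431, 364066904),
  (29922209896378957212063, 378977368), (25530371029928712497567, 173694168),
  (6503921149831666902623, 194632368), (1514936074895976847, 9877168),
  (2495460545548167559, 5688408), (25242430493432985577119, 344251608),
  (762679961564304783, 11381832), (2315528718890215823, 6742704), (1164556702584235407, 5982808),
  (1477930842707109455, 11414600), (3046023545090561423, 11413104),
  (460591582628193871, 11413104), (1271600957529609615, 11614320), (1188992179320035975, 5684312),
  (406754813974062415, 5884528), (2486696568314045831, 5422168), (378959505830614415, 5982936),
  (389959741707298383, 11478088), (2491995162190109071, 13543504), (19708287886464399, 13510224),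
  (12140437140415643542943, 194632848), (3044438100924864143, 13509704),
  (1533056026521786703, 9747600), (24836269577863, 181936), (1177859951254137167, 9809000),
  (1758205130243204751, 9878608), (158334684911235, 154288), (2460677754411706695, 9809000),
  (1442711630714854023, 9906768), (184811005564551, 154792), (105631860763011, 154728),
  (21354779180708415302047, 498280528), (696549827309906567, 7785568),
  (4894590437792701635167, 497634400), (1615263022054025551, 5433584),
  (40312298225239555746399, 497320242), (3002025567431600711, 7687272),
  (2451512103935846727, 7482472), (2676618053487943899743, 506907808),
  (1316640435675503247, 7777568), (438397939086698895, 7531600), (1775978002319316559, 8079968),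
  (2779343491, 117424), (2711261625492875591, 7654064), (2960103652290352783, 13543512),
  (186167544815130959, 5454432), (20220525532114160298655, 366131288),
  (2822957861761023911519, 344150249), (3026465226333198671, 5434584),
  (11637379673266575, 13510224), (1590994880545072463, 5716056), (1896092855988557127, 5720800),
  (1754337965243803279, 13711968), (191007788672657039, 5454432), (11430877827, 3280),
  (698689, 50), (187287780104519, 117425), (187219043588679, 85209), (181851437835591, 88305),
  (168655150818631, 117425), (182547461351751, 89313), (186462152316487, 152817),
  (152376893417031, 146097), (41946304653639, 122153), (110597993309767, 117921),
  (150176309537095, 117929), (88599292373575, 178353), (146813149157703, 154857),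
  (6083488065, 3233), (6486075971, 2289), (385151684081723727, 3816112),
  (299952829406816847, 5651560), (2982968811560998543, 7515232), (384575726807328335, 3787440),
  (109927345479325263, 5716056), (1302273119111195279, 3848368), (118687411161635215, 9780328),
  (1627511846012082575, 9350224), (2690515008333965647, 3824368), (317883494549842255, 7817824),
  (2956789392148375183, 7546960), (1609509533491242575, 7547488), (117279087291011, 122144),
  (93916596181319, 117896), (158356877257283, 154224), (1849296448255596103, 7776368),
  (117206298929829511, 7740584), (99666417592899, 121952), (1441188457327798919, 7777376),
  (654870865391294031, 7784624), (1869365560042353763999, 378975856), (23129852912967, 177264),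
  (1173910778964257423, 9348720), (2405632869225109063, 5684312),
  (7829094786801540180575, 242375848), (7840236746440823118495, 192596144),
  (473169767768414607, 8018608), (186078502842947983, 9350216), (306290578965505415, 5688536),
  (1226219919434754631, 5921896), (2973794494864317007, 9343664), (384501856121542991, 5683312),
  (23800920581447, 146536), (1741081371647518351, 5651056), (49077852600350664205919, 192597152),
  (2621381243347576207, 7547488), (599280446733982095, 5716576), (163825326204033423, 5715552),
  (2346473683732289871, 7546952), (2982866899171976591, 7547488), (2604248636584269391, 5454424),
  (2774517718700173903, 5622880), (39725357900566998115935, 242666640),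
  (167308561876675215, 11412592), (117489983204971919, 11413104), (2317405566547875215, 11379824),
  (140843393047111, 179280), (1914337749082220111, 11414600),
  (23950328101755406690655, 192597136), (1254721242818782607, 9380968),
  (92756542887716431, 9909864), (97202989585295695, 9378448), (2491662768531727951, 9382480),
  (2325423822722192783, 9284712), (92508873585944911, 9284712), (2596982188851702415, 10050664),
  (362088283684628879, 9910856), (1193896343723747727, 9780328), (2686689185312172431, 3824872),
  (1538161313482103439, 3881320), (2695440010538755727, 9382480), (1443867136141973903, 9380936),
  (3050243327977494927, 3618960), (1542070856591235407, 9747600), (2686438489562962575, 3554448),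
  (1775837338675008911, 11146480), (437228100257490575, 11414600),
  (1199528051661776207, 11615304), (78278109411317327, 11478600), (71101728512643, 80496),
  (17603276221059, 154288), (105555618802307, 154728), (10738117249, 2416),
  (1236893583956159119, 7784624), (1536297382439442767, 7654064), (2349020046092245319, 7744616),
  (2307119965361514887, 7777376), (2691554259468982607, 5401328), (1585727376135116423, 7654568),
  (1730883402377827975, 7654064), (158371190052227, 121456), (2919820632728709455, 7809632),
  (3046163537653818703, 7654568), (92370335591043, 122016), (28714989054282955073951, 378977368),
  (21551600046660222621023, 363987185), (2616628859681482375, 5921520),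
  (2352191927767181895, 5683312), (184999838574919, 177840), (23547717462343, 178352),
  (190315123260876367, 5086504), (23709656720711, 179280), (24232795790291772282207, 379009624),
  (2762995087294702991, 9382488), (2960137737155798607, 5716576), (672769542465345167, 9284712),
  (49107906316640838113631, 345669873), (2349217962354190927, 5651560),
  (2423096481433430671, 5885288), (2997453849488939343, 5716072), (1153002490851666247, 5922024),
  (2406475134851982927, 5720296), (1231348115942254927, 3292328), (2330727785760659087, 5651560),
  (180287230888814215, 5643496), (2961575824079559247, 5716056), (720948290778736007, 5720800),
  (118665210187389327, 9780328), (2604657914196633231, 9382480), (677134534489581199, 5651560),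
  (1767744241773685327, 5636337), (1298895222078003791, 11414616),
  (38175583333087049247391, 244791960), (2673196813263477135, 11679344),
  (1820694611662383439, 3853536), (2740621334564939407, 11109681),
  (1766911211553330575, 11478608), (726506265439217039, 11479128), (1556158192814823055, 3885784),
  (3053837546893515407, 11381840), (3044897983404873295, 11414608),
  (1897148585847986575, 11413104), (2964871142765598287, 3824792), (165379236865347, 177840),
  (442553578763430543, 3325080), (1738848659745449359, 3787440), (1754506744639956367, 3337368),
  (23546627254599, 190256), (187283502881095, 179344), (2325626679330433615, 13543504),
  (148713425579911823, 13510224), (2765317449440713359, 13809744), (187301001582979, 206928),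
  (4305103427, 2737), (2496610867527, 116913), (72938637924679, 84721), (11313441347, 3225),
  (11409926723, 2289), (187013187332423, 117425), (11007535681, 2996), (169964901930311, 93545),
  (11414121027, 3233), (1536454708109338959, 3787440), (308013229753932175, 7482472),
  (3055035209952618127, 5422168), (116170449132163, 80816), (3044619554942265743, 3001488),
  (11447654019, 3208), (295449295603521935, 5651056), (2982584056332068431, 7514224),
  (168891122019116367, 7478440), (1623079686326888847, 5622880), (2690514390311348559, 5683312),
  (100581514073970255, 5684312), (618691177861524047, 9779824), (1533493902381328719, 9348208),
  (2424490650331879823, 9780328), (1250035914921040527, 3759336), (2491903786728380047, 3554448),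
  (2763247086178310543, 7784560), (1270474237032109455, 7687264), (2605637328346720591, 7514224),
  (461638384341113167, 7515232), (1919819201601231247, 7515216), (151338505305758095, 7514224),
  (623072771083446607, 7785568), (1884092495438632335, 7686768), (2396647351031064207, 3583264),
  (1182662635553203599, 7513200), (381299712980527695, 3271344), (3053478301555923599, 7515208),
  (3062889910700251471, 5986904), (1519499328070789711, 5453912), (2491728168975178127, 5557464),
  (1322090278472558991, 5454424), (1484246527158954319, 3038352), (38564545872702031, 5453384),
  (315719568438486607, 11413104), (667000681825461903, 7784624), (2469210742065818191, 5922024),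
  (473195007468788303, 9350216), (1846521015604701839, 9780296), (187562654542403, 174192),
  (116575435336263, 146032), (1808235010279974543, 7547488), (1840100164251593039, 7785632),
  (380066718281262735, 7817800), (3066952748916975247, 7546952), (88121545500995, 206432),
  (89440925689159, 117856), (2900768033262445903, 7547464), (87984106531395, 117856),
  (1789569665, 2416), (87965316065923, 121456), (477403723914193223, 7654064),
  (297545551985682831, 7654568), (2461244282995320135, 5651056), (648962938355673671, 5683312),
  (46463330985607, 146096), (696534368539809351, 5643496), (295449310364345935, 5651560),
  (1819753764741621391, 5651560), (2740627317220289103, 5636337), (150257864910147, 88304),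
  (1160347170844092047, 7515232), (1842259861713888847, 5684320), (1898656567400162703, 5921520),
  (164003588620065167, 3791536), (144546551596214855, 5922024), (1334377763649972623, 5622888),
  (2964569657889695311, 5683312), (44626226009735, 117424), (1232106522404297039, 5454432),
  (2406510318946985615, 5716056), (182965981845123, 89312), (1376131593394787559839, 242665648),
  (23252993223047, 176816), (81365622741635, 178352), (3000910710775064143, 9284208),
  (10858873834875279, 9284208), (1227556721462438479, 9284712), (389074576603781455, 9877104),
  (1551496965499033935, 5921521), (1939961751126176864927, 240278760),
  (326529014558206543, 3587224), (1307761906931116623, 3586224), (189302961658571343, 3553968),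
  (1155455434419251855, 9350224), (1253700563575134543, 9339057), (457491503155669327, 3824792),
  (1250495007653730895, 9780328), (5126457301319, 154352), (1248221218224035471, 3548400),
  (158338941102723, 157040), (141298021082755, 146096), (2702618846776682063, 7687272),
  (3063680739806914895, 7547488), (1460875557361854031, 7817824), (306669547567077007, 7543456),
  (1875004073987188303, 3619488), (171882901189335695, 3618464), (2982601596897764751, 3525792),
  (5411044107213818193567, 192597152), (1840099893815449167, 7547488),
  (2992811850960628367, 3271344), (460090755148769935, 3325080), (1914071183269668239, 7546960),
  (2415413090891422095, 7817824), (168947275684483, 122152), (1317894508364851599, 3792040),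
  (618227369700403791, 3352424), (150313798780757647, 7654560), (1321336546759431823, 7547488),
  (167135710718279, 122144), (38644082691970447, 11413104), (3035448518424307343, 11613808),
  (2991891691757803855, 11412592), (367616594862040463, 11414608), (70755334662791, 179280),
  (1250421963643856207, 9909864), (2384700354964384335, 9284712), (2905949334692866383, 9284712),
  (3049034144541141583, 9380968), (150136738963679567, 9382480), (2402294460744898127, 5919472),
  (46551373600391, 146536), (745738308300401039, 2746736), (99534408930947, 142440),
  (2621236449174251919, 9910864), (686892008008751439, 9780328), (2686866279038867087, 10050664),
  (187558706633347, 206928), (331403359871997583, 9016688), (299929277183994511, 9382480),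
  (37944329672323, 142377), (146401096194695, 146512), (11636854904195, 152240),
  (3068386279288302159, 11479128), (88074379499075, 207456), (325554947932973711, 10847026),
  (115871142548871, 207448), (11447981635, 2225), (10914998849, 1841), (1741703259719, 84209),
  (2857986625, 2737), (9204034113, 3241), (164212338502215, 60080), (176081488729479, 142440),
  (2690409461706234447, 7481968), (1626456051667348047, 3525792), (2335233093906557583, 5420656),
  (1249329313293702735, 5389416), (1249362299246454351, 5921896), (673675797410195791, 5389400),
  (1515929689488008783, 3787920), (23473382140231, 173680), (23798420777351, 173168),
  (70480423201415, 175176), (187288870540679, 146032), (1164485457537046863, 7514224),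
  (114376412146243, 117360), (2469408165019100559, 7478440), (473301915645859471, 7482440),
  (89449808898631, 117856), (87963525027203, 159080), (81347750211003791, 5422168),
  (694227870819985039, 5557464), (2709197933536519503, 5422152), (23478809568839, 174192),
  (2906054691917556047, 5687408), (2784792793695557263, 3074224), (73277802981955, 191768),
  (28896291272169871, 3075216), (94122737510983, 206928), (1815316440711, 206408),
  (140748248427139, 88304), (3068224127947400591, 5622384), (759301189424228943, 5622888),
  (2964607266891392591, 5683312), (617732112071173775, 3292328), (175944566745667, 89184),
  (2406752223927621007, 3553968), (3045915594372830799, 3548400), (313282312993876367, 7514224),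
  (2748684855463794255, 7686768), (2975199954524088911, 3525296), (24913131448963, 121648),
  (92997489874567, 117424), (604231570179138895, 7478440), (2614803670564772431, 7687272),
  (673572185854089551, 7482472), (1758840529516914319, 3525800), (650812084407872079, 3525792),
  (147979970712967, 109672), (151364484635267, 125296), (462070043532502671, 7482472),
  (2402293913321383247, 3524784), (2928912490667006351, 5422176), (150063865594029711, 3824872),
  (1177203532087600783, 3292312), (2686828625871137359, 5687408), (77213918536832655, 3587232),
  (2686496454436346511, 3037872), (577965452531688847, 5171312), (2882693150388345231, 3787440),
  (1914194848448604751, 5422168), (22723201424003, 84720), (98410898826887, 80816),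
  (748767531968665167, 3325080), (2582963198343, 206936), (176563327243847, 207448),
  (1265565522567, 206416), (385621158367242831, 9348208), (38726489946303055, 5919472),
  (1249231122618280591, 9779824), (76323759696455, 146536), (3046003612213143951, 9780328),
  (2402131735637027407, 5919472), (116824883222919, 146512), (11573148691011, 152240),
  (146945482597767, 144496), (2307681548488059535, 7784560), (726915334009427535, 7513200),
  (2762503608487029071, 5682992), (315630593153324687, 7783088), (2348667416611301967, 3791664),
  (2691641869839279695, 7514224), (1466581480755324495, 7515232), (1325612321911499087, 7687264),
  (405326549225216399, 7513200), (2596714440322292367, 3792168), (383461923822868047, 7514224),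
  (2562327156103, 117360), (761394868694705807, 7515216), (167804256922528079, 7686768),
  (176018050886211, 175137), (1753633722715433295, 5557480), (110064615184003, 191776),
  (2956701282194778703, 7785568), (44004802123395, 117360), (140747330721155, 117360),
  (3054185270095750799, 5688544), (2618095895121140303, 5720672), (1730025029377894735, 5986904),
  (2478486512826230095, 5446368), (187214561122887, 207456), (94867935615559, 206936),
  (2919574324216751503, 5454424), (2963651232534276751, 5453912), (97472782640515, 80992),
  (90549018863175, 205920), (650071286666140047, 5374193), (106267532700295, 89312),
  (183214168647, 206928), (95211824614889871, 11413104), (1898830644438002063, 5921521),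
  (20420595652227, 175192), (146893278193287, 146032), (152102350772871, 146536),
  (309171204427261263, 7547488), (2420853319340305039, 7654568), (2990554161425590671, 7785632),
  (6161754072647, 207456), (97204075931015, 206432), (94568301880967, 122152),
  (29165144675971, 117864), (45107200566595, 117360), (114976984831623, 207448),
  (3055156999496510095, 7547488), (178956929, 1840), (2317265038972982863, 7784625),
  (4339706499, 2800), (11443464771, 1713), (10906610241, 2225), (89449146198599, 109664),
  (181858938300743, 141936), (22010274600323, 117360), (2487558583400950095, 5388912),
  (1478959836208736911, 3525792), (90160266651011, 85080), (46816576498243, 173680),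
  (17695644494215, 142440), (149626282404419, 142440), (2912222592738895, 3525776),
  (11658699582023, 142408), (386657855111, 175176), (151828526705219, 178352),
  (2461384906677840527, 3524784), (400839206045919823, 3525296), (97199139030996367, 5388912),
  (151742312786243, 92528), (82632996001506895, 5622888), (604714260127635855, 3493088),
  (1534062022216030799, 3787440), (4306152067, 2736), (1608420207911151183, 3787944),
  (181568305453703, 142440), (181854593001799, 142424), (81989485636167, 142440),
  (46809063205255, 55472), (181807711955527, 144496), (725542823140174159, 7475888),
  (159807836936775, 117360), (2765353479593171599, 7481968), (7327839857283, 116848),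
  (2637219709083871567, 5557480), (29281384830595, 117856), (11725886089859, 117864),
  (1464347550216201871, 5421168), (383555309800172111, 5420656), (1829747482756278671, 5556976),
  (143650841864771, 84592), (149910028355787151, 5389416), (600263409676228943, 5381352),
  (2783613412790867535, 3040944), (666961710152329615, 5389416), (1342504944810760527, 5557480),
  (2384113215027452559, 5389400), (11288895444359, 142377), (96767379663491, 159080),
  (3067120230135601743, 5921896), (1914457934320544335, 5387888), (20437960926791, 93545),
  (1604977234888268431, 5374193), (452735949383, 88304), (150229545035079, 89312),
  (177650742696519, 175192), (380080848794905167, 3824304), (140850543109511, 173680),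
  (158770585491843, 174192), (140845979706759, 174192), (398658830363961999, 3074224),
  (163422063466119, 175184), (326029982035503759, 3325080), (1728072558211, 191768),
  (186395834885511, 173680), (439515261511, 173168), (45245778257287, 207440),
  (88349663931015, 206928), (81435088759175, 146032), (3067239505630751311, 7514224),
  (92365512157827, 117360), (2402838169759606159, 7686768), (27939388942663, 121648),
  (2983219492761790095, 7478440), (581568645397386895, 7654568), (99654423910019, 117864),
  (46893682502275, 117856), (90733955164743, 109672), (44621931107975, 116912),
  (11006225025, 2101), (3072882706116617871, 5687408), (7256989603463, 154856),
  (2380601650513095055, 5422176), (22722697865859, 154795), (684917856576055695, 3056944),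
  (88276955998787, 179360), (176495396297287, 174195), (186373774157191, 175192),
  (2349300558103751055, 5171312), (28744779127431, 174192), (165101400840839, 84720),
  (187009495111303, 207456), (434116132352727695, 3824872), (185897360647815, 209568),
  (2656480962951, 206936), (184857986246023, 207448), (44009012947587, 207448),
  (177204338792771, 44384), (39495235, 1265), (117178076146055, 109168), (44627420423815, 80984),
  (90738341270915, 141936), (1282419631687, 117920), (114525477710407, 109640),
  (11641871291783, 55472), (35349282007623, 109168), (11100705413511, 80992),
  (39602460710275, 116848), (1271431907206915727, 5387888), (3000832602268146255, 3525296),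
  (180364643837315, 84592), (180760784250247, 85088), (1247502634707494479, 3525296),
  (41069187848775, 140400), (149630577371715, 141873), (76255707420295, 141936),
  (22103589562759, 109672), (97971057551943, 109664), (3037795074594940495, 3525792),
  (95129858386503, 109672), (182978980423, 109664), (18874605676103, 117928),
  (94672447514951, 52376), (164279690635591, 173680), (116628067624327, 142440),
  (108380723778947, 142440), (22033821231751, 152816), (177645908813447, 142416),
  (37970288142723, 140912), (5944391670087, 116912), (167199493478019, 117360),
  (6980020865, 2996), (1243636180518070671, 5388912), (6353399735555727, 5374193),
  (151081542392131, 84531), (35641081834119, 92528), (2622530303577205071, 5622888),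
  (108132350666311, 85096), (89232398523015, 116913), (142569986415235, 85096),
  (187012982872647, 174192), (3063758526178028111, 3324080), (71926367820167, 173680),
  (165036439541319, 51888), (99252708223559, 142440), (470699023664765519, 3288296),
  (115484786321799, 93544), (46258165492359, 146600), (146340568541511, 140912),
  (164398843472199, 142440), (105734085191047, 142440), (2388495937166550415, 3524784),
  (98434900728455, 142424), (5612069608007, 56544), (181527893420615, 55536), (2510989635, 2224),
  (151734392084867, 178352), (23125221353799, 174192), (99036079695495, 174192),
  (114770797046151, 175192), (114360660351363, 191768), (168782107141767, 207456),
  (6084536641, 3232), (698945, 49), (642794563207, 80496), (187489367464583, 48272),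
  (186247321135431, 108656), (187546820057479, 80496), (184856912500359, 52376),
  (184815036552579, 140912), (44145375029827, 117424), (186171162798727, 109168),
  (6637504600711, 85216), (6075940772487, 80984), (97146423827015, 80992), (11274660481, 1840),
  (76974448354691, 84080), (182958785468743, 84592), (1915197955033901455, 3524784),
  (11100924227, 2224), (187004594329159, 109168), (1230786862501947983, 3525296),
  (2549676071559, 51888), (142275366005383, 109168), (165504507882055, 50864),
  (97318230205831, 84209), (152371097917059, 81000), (163844759136647, 80992),
  (1814242436743, 141873), (146948374571335, 140400), (185356184611207, 141936),
  (6943505279559, 109672), (10549129287303, 117920), (81521254426951, 115376),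
  (186941230639431, 117928), (74914607027591, 109672), (97411310200455, 120112),
  (11275692673, 3160), (143041907828359, 174192), (11276823169, 2672), (37767901452935, 146600),
  (26547367613763, 60776), (694835843, 3168), (180434428598915, 140912), (11450886787, 2672),
  (187348980246855, 79984), (116635581720135, 47792), (11418294915, 3152),
  (186257169082759, 50864), (2313470450055, 79984), (164147913910919, 51888),
  (177734427518535, 115376), (162910700218951, 108656), (35761578142343, 84720),
  (70802614168199, 80496), (105588860822915, 80496), (4564078713223, 56608), (11367262595, 3160),
  (8888743782023, 140912), (35344941163911, 117424), (9934907969, 2672), (2779425089, 2996),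
  (642251396679, 81000), (182937023326599, 84209), (1655335553, 3371), (359311939, 2160),
  (183148840593799, 79472), (88276242967175, 47280), (1454025281, 2672), (11285129859, 1712),
  (98411686308487, 79984), (6040496769, 2419), (146888193649031, 56112), (15662229891, 2672),
  (5916764737, 3168), (11452192131, 1648), (11409119873, 1264), (169966226287239, 46768),
  (712701443, 2160), (7709831875, 2672), (11452196227, 1136), (11316587137, 1648),
  (11449051715, 688), (699009, 48)]

/-! ### Kernel computations -/

theorem atlasCatalogue_bounds :
    ∀ p ∈ atlasCatalogue, p.1 < 8 ∧ p.2 < 2 ^ (p.1 * (p.1 - 1) / 2) := by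
  decide +kernel

theorem length_atlasCatalogue : atlasCatalogue.length = 1252 := by decide +kernel

theorem length_minRankTable : minRankTable.length = 1252 := by decide +kernel

theorem extensionData_check :
    pairwiseAll (fun p l => extensionCheck p.1 p.2 (Nat.pow 2 p.1) l)
      (atlasCatalogue.filter fun p => Nat.ble p.1 6) extensionData = true := by
  decide +kernel

theorem certificates_check :
    pairwiseAll rowCheck (atlasCatalogue.zip minRankTable) certificates = true := by
  decide +kernel

theorem codeInvariant_check :
    distinctFrom (atlasCatalogue.map fun p => Nat.mod (codeInvariant p.1 p.2) 76747) 0 = true := by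
  decide +kernel

/-! ### The table -/

theorem exists_mem_of_entryCheck {n c e : ℕ} (h : entryCheck n c e = true) :
    ∃ d, (n, d) ∈ atlasCatalogue ∧ Nonempty (codedGraph n c ≃g codedGraph n d) := by
  rw [entryCheck] at h
  cases h1 : Nat.ble 1252 (Nat.mod e 2048)
  · rw [h1, cond_false, Bool.cond_false_right, Bool.and_eq_true, Nat.beq_eq] at h
    obtain ⟨⟨n', d⟩, hp, hd⟩ := shiftRight_foldr_mod_mem (l := atlasCatalogue) (fun p hp => by
      obtain ⟨h2, h3⟩ := atlasCatalogue_bounds p hp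
      have h4 : p.1 * (p.1 - 1) / 2 ≤ 21 :=
        Nat.div_le_div_right (c := 2) (Nat.mul_le_mul (Nat.le_of_lt_succ h2)
          (Nat.sub_le_sub_right (Nat.le_of_lt_succ h2) 1))
      exact ⟨h2, h3.trans_le (Nat.pow_le_pow_right two_pos h4)⟩)
      (j := Nat.mod e 2048) (by rw [length_atlasCatalogue]; exact ble_eq_false_iff.1 h1)
    have hd' : atlasDigit (Nat.mod e 2048) = 8 * d + n' := hd
    have hn' : n' < 8 := (atlasCatalogue_bounds _ hp).1
    have h5 : Nat.mod (8 * d + n') 8 = n' := by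
      change (8 * d + n') % 8 = n'
      omega
    have h6 : Nat.div (8 * d + n') 8 = d := by
      change (8 * d + n') / 8 = d
      omega
    rw [hd', h5, h6] at h
    obtain ⟨rfl, h⟩ := h
    obtain ⟨φ⟩ := nonempty_iso_of_isoCheck h
    exact ⟨d, hp, ⟨φ.symm⟩⟩
  · simp [h1] at h

/-- The catalogue is complete. -/
theorem exists_mem_atlasCatalogue {n : ℕ} (h1 : 1 ≤ n) (h7 : n ≤ 7) (G : SimpleGraph (Fin n)) :
    ∃ c, (n, c) ∈ atlasCatalogue ∧ Nonempty (G ≃g codedGraph n c) := by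
  classical
  induction n, h1 using Nat.le_induction with
  | base =>
    exact ⟨0, by decide +kernel,
      ⟨Subsingleton.elim (codedGraph 1 0) G ▸ SimpleGraph.Iso.refl⟩⟩
  | succ n h1 ih =>
    obtain ⟨v, hv⟩ := G.exists_maximal_degree_vertex
    let σ : Fin (n + 1) ≃ Fin (n + 1) := Equiv.swap v (Fin.last n)
    let ψ : G.comap σ ≃g G := SimpleGraph.Iso.comap σ G
    obtain ⟨c, hc, ⟨φ⟩⟩ := ih (by omega) ((G.comap σ).comap Fin.castSucc)
    obtain ⟨m, hm, hmax, ⟨θ⟩⟩ := exists_iso_extensionCode (atlasCatalogue_bounds _ hc).2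
      (fun u => by
        rw [← ψ.degree_eq, ← ψ.degree_eq]
        have : ψ (Fin.last n) = v := Equiv.swap_apply_right v (Fin.last n)
        rw [this, ← hv]
        exact G.degree_le_maxDegree _) φ
    obtain ⟨l, hl⟩ := exists_of_pairwiseAll extensionData_check (a := (n, c))
      (List.mem_filter.2 ⟨hc, by rw [Nat.ble_eq]; omega⟩)
    obtain ⟨e, he⟩ := exists_entryCheck_of_extensionCheck hl hm hmax
    obtain ⟨d, hd, ⟨χ⟩⟩ := exists_mem_of_entryCheck he
    exact ⟨d, hd, ⟨(ψ.symm.trans θ).trans χ⟩⟩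

theorem getElem_inj_of_distinctFrom_map {α : Type*} {l : List α} {f : α → ℕ}
    (h : distinctFrom (l.map f) 0 = true) {i j : ℕ} (hi : i < l.length) (hj : j < l.length)
    (hij : f l[i] = f l[j]) : i = j :=
  ((nodup_of_distinctFrom h).1.getElem_inj_iff (hi := by simpa using hi)
    (hj := by simpa using hj)).1 (by simpa using hij)

/-- The graphs of the catalogue are pairwise non-isomorphic. -/
theorem atlasCatalogue_place_unique {i j : ℕ} (hi : i < atlasCatalogue.length)
    (hj : j < atlasCatalogue.length)
    (φ : codedGraph (atlasCatalogue[i]).1 (atlasCatalogue[i]).2 ≃g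
      codedGraph (atlasCatalogue[j]).1 (atlasCatalogue[j]).2) : i = j :=
  getElem_inj_of_distinctFrom_map codeInvariant_check hi hj (congrArg (Nat.mod · 76747) (by
    rw [codeInvariant_eq_closedInvariant, codeInvariant_eq_closedInvariant, φ.closedInvariant_eq]))

theorem getElem_pair_mem_zip {α β : Type*} {l : List α} {l' : List β} {i : ℕ}
    (hi : i < l.length) (hi' : i < l'.length) : (l[i], l'[i]) ∈ l.zip l' := by
  rw [← List.getElem_zip (h := by simp [hi, hi'])]
  exact List.getElem_mem _

/-- The rows of the table are correct for the graphs at the same places of the catalogue. -/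
theorem minRankTable_correct {V : Type*} [Fintype V] (G : SimpleGraph V) {p : ℕ × ℕ}
    {row : TableRow} (hmem : (p, row) ∈ atlasCatalogue.zip minRankTable)
    (φ : G ≃g codedGraph p.1 p.2) :
    Fintype.card V = row.order ∧ G.edgeSet.ncard = row.size ∧ G.minRank = row.mr ∧
      Fintype.card V = row.mr + G.zeroForcingNumber := by
  obtain ⟨d, hd⟩ := exists_of_pairwiseAll certificates_check hmem
  simp only [rowCheck, Bool.cond_false_right, Bool.and_eq_true, Nat.beq_eq,
    sumBelow_codeDegree] at hd
  obtain ⟨h1, h2, h3, h4⟩ := hd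
  have hcard : Fintype.card V = p.1 := (Fintype.card_congr φ.toEquiv).trans (Fintype.card_fin _)
  have hmr := minRank_le_of_matrixCheck φ h3
  have hz := zeroForcingNumber_add_le_of_forcingCheck φ h4
  have hle := G.card_le_minRank_add_zeroForcingNumber
  refine ⟨by rw [hcard, h1], ?_, by omega, by omega⟩
  rw [φ.ncard_edgeSet_eq]
  exact Nat.eq_of_mul_eq_mul_left two_pos h2

theorem atlasGraph_iso_iff {V : Type*} {G : SimpleGraph V} {k : ℕ}
    (hk : k - 1 < atlasCatalogue.length) : Nonempty (G ≃g atlasGraph k) ↔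
      Nonempty (G ≃g codedGraph (atlasCatalogue[k - 1]).1 (atlasCatalogue[k - 1]).2) := by
  have h : atlasCatalogue.getD (k - 1) (0, 0) = atlasCatalogue[k - 1] :=
    List.getD_eq_getElem _ _ hk
  change Nonempty (G ≃g codedGraph (atlasCatalogue.getD (k - 1) (0, 0)).1
    (atlasCatalogue.getD (k - 1) (0, 0)).2) ↔ _
  rw [h]

/-- Every graph `G` of order one to seven is isomorphic to graph `k` of the *Atlas* for exactly one
`k` from 1 to 1252, and row `k` of the table lists the order, the size and the minimum rank of `G`;
if `G` is connected, then this minimum rank is also the zero forcing lower bound `|G| - Z(G)`. -/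
theorem mainTheorem1 {V : Type*} [Fintype V] (G : SimpleGraph V)
    (hpos : 1 ≤ Fintype.card V) (hle : Fintype.card V ≤ 7) :
    (∃! k : ℕ, k ∈ Finset.Icc 1 1252 ∧ Nonempty (G ≃g atlasGraph k)) ∧
    ∀ k ∈ Finset.Icc 1 1252, Nonempty (G ≃g atlasGraph k) →
      Fintype.card V = (tableRow k).order ∧
      G.edgeSet.ncard = (tableRow k).size ∧
      G.minRank = (tableRow k).mr ∧
      (G.Connected →
        (Fintype.card V : ℤ) - (G.zeroForcingNumber : ℤ) = ((tableRow k).mr : ℤ)) := by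
  have hplace : ∀ k ∈ Finset.Icc 1 1252, k - 1 < atlasCatalogue.length := fun k hk => by
    rw [length_atlasCatalogue]
    have := Finset.mem_Icc.1 hk
    omega
  refine ⟨?_, fun k hk hiso => ?_⟩
  · let e := (Fintype.equivFin V).symm
    obtain ⟨c, hc, ⟨φ⟩⟩ := exists_mem_atlasCatalogue hpos hle (G.comap e)
    obtain ⟨i, hi, hic⟩ := List.getElem_of_mem hc
    have hk : i + 1 ∈ Finset.Icc 1 1252 := by
      rw [Finset.mem_Icc, ← length_atlasCatalogue]
      omega
    have hiso : Nonempty (G ≃g atlasGraph (i + 1)) := by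
      rw [atlasGraph_iso_iff (hplace _ hk)]
      have hic' : atlasCatalogue[i + 1 - 1] = (Fintype.card V, c) := hic
      rw [hic']
      exact ⟨(SimpleGraph.Iso.comap e G).symm.trans φ⟩
    refine ⟨i + 1, ⟨hk, hiso⟩, fun k ⟨hk', hiso'⟩ => ?_⟩
    obtain ⟨ψ⟩ := (atlasGraph_iso_iff (hplace _ hk)).1 hiso
    obtain ⟨ψ'⟩ := (atlasGraph_iso_iff (hplace _ hk')).1 hiso'
    have h := atlasCatalogue_place_unique (hplace _ hk') (hplace _ hk) (ψ'.symm.trans ψ)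
    have := Finset.mem_Icc.1 hk'
    omega
  · obtain ⟨φ⟩ := (atlasGraph_iso_iff (hplace k hk)).1 hiso
    have hk' : k - 1 < minRankTable.length := by
      rw [length_minRankTable, ← length_atlasCatalogue]
      exact hplace k hk
    have hrow : tableRow k = minRankTable[k - 1] := List.getD_eq_getElem _ _ hk'
    obtain ⟨h1, h2, h3, h4⟩ := minRankTable_correct G (getElem_pair_mem_zip (hplace k hk) hk') φ
    rw [hrow]
    exact ⟨h1, h2, h3, fun _ => by omega⟩
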